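/- Let $\Bbbk$ be an algebraically closed field with $\operatorname{char}\Bbbk\neq 2$. A superalgebra is a finite-dimensional unital associative $\mathbb{Z}_2$-graded $\Bbbk$-algebra $A=A_{\bar 0}\oplus A_{\bar 1}$; write $\partial x$ for the degree of a homogeneous element $x$. The super centre $s\mathcal{Z}(A)$ is the subalgebra of $A$ spanned by the homogeneous $x\in A$ with $xy=(-1)^{\partial x\,\partial y}yx$ for all homogeneous $y\in A$; the anti centre $a\mathcal{Z}(A)$ is the subspace of $A$ spanned by the homogeneous $x\in A$ with $xy=(-1)^{(\partial x+1)\partial y}yx$ for all homogeneous $y\in A$. The abstract (exterior) direct sum $s\mathcal{Z}(A)\oplus a\mathcal{Z}(A)$ is a $\Bbbk$-algebra with product $(s,a)(s',a')=(ss'+aa',\,sa'+as')$. Let $A\text{-gmod}$ be the abelian category of finite-dimensional $\mathbb{Z}_2$-graded left $A$-modules with $A$-linear maps that preserve the grading, and let $\mathcal{D}^b(A)$ denote its bounded derived category. Let $\mathbf{\Pi}$ be the parity shift, $(\mathbf{\Pi}M)_i=M_{i+\bar 1}$, which does not change the underlying module or the maps, and also the functor that it induces on $\mathcal{D}^b(A)$;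 thus $\mathbf{\Pi}^2=\mathrm{Id}$. A triangulated $\mathbf{\Pi}$-functor $F:\mathcal{D}^b(A)\to\mathcal{D}^b(B)$ is a $\Bbbk$-linear triangulated functor with a natural isomorphism $\xi^F:\mathbf{\Pi}\circ F\Rightarrow F\circ\mathbf{\Pi}$ such that $\xi^F_{\mathbf{\Pi}}\circ\mathbf{\Pi}(\xi^F)$ is the identity of $F$ under the identification $\mathbf{\Pi}^2=\mathrm{Id}$. It is called strong if the image of the left regular module ${}_AA$ is isomorphic in $\mathcal{D}^b(B)$ to a complex concentrated in one degree. Theorem. Let $A,B$ be superalgebras, and let $F:\mathcal{D}^b(A)\to\mathcal{D}^b(B)$ be a strong triangulated $\mathbf{\Pi}$-functor which is an equivalence of categories and which admits a quasi-inverse $\mathcal{D}^b(B)\to\mathcal{D}^b(A)$ that is also a strong triangulated $\mathbf{\Pi}$-functor. Then there are isomorphisms of $\Bbbk$-algebras $$s\mathcal{Z}(A)\cong s\mathcal{Z}(B)\quad\text{and}\quad s\mathcal{Z}(A)\oplus a\mathcal{Z}(A)\cong s\mathcal{Z}(B)\oplus a\mathcal{Z}(B).$$ -/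

import Mathlib

open CategoryTheory CategoryTheory.Limits

universe u


/-! ### Super centre and anti centre -/

section Centre

variable {k A : Type u} [Field k] [Ring A] [Algebra k A]

/-- Homogeneous elements `x` with `x y = (-1)^{∂x ∂y} y x` for all homogeneous `y`. -/
def superCentreSet (𝒜 : ZMod 2 → Submodule k A) : Set A :=
  {x | ∃ i, x ∈ 𝒜 i ∧ ∀ j, ∀ y ∈ 𝒜 j, x * y = (-1) ^ (i.val * j.val) * (y * x)}

/-- Homogeneous elements `x` with `x y = (-1)^{(∂x + 1) ∂y} y x` for all homogeneous `y`. -/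
def antiCentreSet (𝒜 : ZMod 2 → Submodule k A) : Set A :=
  {x | ∃ i, x ∈ 𝒜 i ∧ ∀ j, ∀ y ∈ 𝒜 j, x * y = (-1) ^ ((i.val + 1) * j.val) * (y * x)}

/-- The anti centre. -/
def antiCentre (𝒜 : ZMod 2 → Submodule k A) : Submodule k A :=
  Submodule.span k (antiCentreSet 𝒜)

theorem neg_one_mul_comm (n : ℕ) (x y : A) : x * ((-1) ^ n * y) = (-1) ^ n * (x * y) := by
  rw [← mul_assoc, ← mul_assoc, ((Commute.neg_one_left x).pow_left n).eq]

theorem even_val : ∀ i i' : ZMod 2, Even ((i + i').val + i.val + i'.val) := by decide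

theorem mul_mem_span {S T U : Set A} (h : ∀ x ∈ S, ∀ y ∈ T, x * y ∈ U) {x y : A}
    (hx : x ∈ Submodule.span k S) (hy : y ∈ Submodule.span k T) :
    x * y ∈ Submodule.span k U := by
  have hxy := Submodule.mul_mem_mul hx hy
  rw [Submodule.span_mul_span] at hxy
  refine Submodule.span_mono ?_ hxy
  rintro _ ⟨x, hx, y, hy, rfl⟩
  exact h x hx y hy

theorem twisted_mul {𝒜 : ZMod 2 → Submodule k A} [GradedAlgebra 𝒜] (c d e : ℕ)
    {x x' : A} {i i' : ZMod 2} (hx : x ∈ 𝒜 i) (hx' : x' ∈ 𝒜 i')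
    (h : ∀ j, ∀ y ∈ 𝒜 j, x * y = (-1) ^ ((i.val + c) * j.val) * (y * x))
    (h' : ∀ j, ∀ y ∈ 𝒜 j, x' * y = (-1) ^ ((i'.val + d) * j.val) * (y * x'))
    (he : Even (c + d + e)) :
    x * x' ∈ 𝒜 (i + i') ∧ ∀ j, ∀ y ∈ 𝒜 j,
      x * x' * y = (-1) ^ (((i + i').val + e) * j.val) * (y * (x * x')) := by
  refine ⟨SetLike.mul_mem_graded hx hx', fun j y hy => ?_⟩
  have hp : (-1 : A) ^ ((i'.val + d) * j.val) * (-1) ^ ((i.val + c) * j.val) =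
      (-1) ^ (((i + i').val + e) * j.val) := by
    rw [← pow_add, neg_one_pow_congr]
    have hv := even_val i i'
    rw [← add_mul, Nat.even_mul, Nat.even_mul]
    have : Even (i'.val + d + (i.val + c)) ↔ Even ((i + i').val + e) := by
      simp only [Nat.even_iff] at hv he ⊢
      omega
    rw [this]
  rw [mul_assoc, h' j y hy, neg_one_mul_comm, ← mul_assoc x y x', h j y hy, mul_assoc _ (y * x) x',
    ← mul_assoc, hp, mul_assoc y x x']

theorem super_mul_super {𝒜 : ZMod 2 → Submodule k A} [GradedAlgebra 𝒜] {x y : A}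
    (hx : x ∈ Submodule.span k (superCentreSet 𝒜)) (hy : y ∈ Submodule.span k (superCentreSet 𝒜)) :
    x * y ∈ Submodule.span k (superCentreSet 𝒜) :=
  mul_mem_span (S := superCentreSet 𝒜) (T := superCentreSet 𝒜) (U := superCentreSet 𝒜)
    (fun _ ⟨_, hi, h⟩ _ ⟨_, hj, h'⟩ => ⟨_, twisted_mul 0 0 0 hi hj h h' (by decide)⟩) hx hy

theorem super_mul_anti {𝒜 : ZMod 2 → Submodule k A} [GradedAlgebra 𝒜] {x y : A}
    (hx : x ∈ Submodule.span k (superCentreSet 𝒜)) (hy : y ∈ antiCentre 𝒜) :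
    x * y ∈ antiCentre 𝒜 :=
  mul_mem_span (S := superCentreSet 𝒜) (T := antiCentreSet 𝒜) (U := antiCentreSet 𝒜)
    (fun _ ⟨_, hi, h⟩ _ ⟨_, hj, h'⟩ => ⟨_, twisted_mul 0 1 1 hi hj h h' (by decide)⟩) hx hy

theorem anti_mul_super {𝒜 : ZMod 2 → Submodule k A} [GradedAlgebra 𝒜] {x y : A}
    (hx : x ∈ antiCentre 𝒜) (hy : y ∈ Submodule.span k (superCentreSet 𝒜)) :
    x * y ∈ antiCentre 𝒜 :=
  mul_mem_span (S := antiCentreSet 𝒜) (T := superCentreSet 𝒜) (U := antiCentreSet 𝒜)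
    (fun _ ⟨_, hi, h⟩ _ ⟨_, hj, h'⟩ => ⟨_, twisted_mul 1 0 1 hi hj h h' (by decide)⟩) hx hy

theorem anti_mul_anti {𝒜 : ZMod 2 → Submodule k A} [GradedAlgebra 𝒜] {x y : A}
    (hx : x ∈ antiCentre 𝒜) (hy : y ∈ antiCentre 𝒜) :
    x * y ∈ Submodule.span k (superCentreSet 𝒜) :=
  mul_mem_span (S := antiCentreSet 𝒜) (T := antiCentreSet 𝒜) (U := superCentreSet 𝒜)
    (fun _ ⟨_, hi, h⟩ _ ⟨_, hj, h'⟩ => ⟨_, twisted_mul 1 1 0 hi hj h h' (by decide)⟩) hx hy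

/-- The super centre, as a subalgebra. -/
def superCentre (𝒜 : ZMod 2 → Submodule k A) [GradedAlgebra 𝒜] : Subalgebra k A :=
  (Submodule.span k (superCentreSet 𝒜)).toSubalgebra
    (Submodule.subset_span ⟨0, SetLike.one_mem_graded 𝒜, fun j y _ => by simp⟩)
    (fun _ _ hx hy => super_mul_super hx hy)

/-- The abstract (exterior) direct sum of the super centre and the anti centre. -/
def SuperAntiSum (𝒜 : ZMod 2 → Submodule k A) [GradedAlgebra 𝒜] : Type u :=
  superCentre 𝒜 × antiCentre 𝒜

namespace SuperAntiSum

variable {𝒜 : ZMod 2 → Submodule k A} [GradedAlgebra 𝒜]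

instance : AddCommGroup (SuperAntiSum 𝒜) :=
  inferInstanceAs (AddCommGroup (superCentre 𝒜 × antiCentre 𝒜))

instance : Module k (SuperAntiSum 𝒜) :=
  inferInstanceAs (Module k (superCentre 𝒜 × antiCentre 𝒜))

/-- The component in the super centre, as an element of the algebra. -/
def fst (x : SuperAntiSum 𝒜) : A := (Prod.fst x).1

/-- The component in the anti centre, as an element of the algebra. -/
def snd (x : SuperAntiSum 𝒜) : A := (Prod.snd x).1

@[ext]
theorem ext {x y : SuperAntiSum 𝒜} (h1 : x.fst = y.fst) (h2 : x.snd = y.snd) : x = y :=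
  Prod.ext (Subtype.ext h1) (Subtype.ext h2)

/-- The product `(s, a) (s', a') = (s s' + a a', s a' + a s')`. -/
instance : Mul (SuperAntiSum 𝒜) where
  mul x y :=
    (⟨x.fst * y.fst + x.snd * y.snd,
        add_mem (super_mul_super x.1.2 y.1.2) (anti_mul_anti x.2.2 y.2.2)⟩,
      ⟨x.fst * y.snd + x.snd * y.fst,
        add_mem (super_mul_anti x.1.2 y.2.2) (anti_mul_super x.2.2 y.1.2)⟩)

instance : One (SuperAntiSum 𝒜) := ⟨((1 : superCentre 𝒜), (0 : antiCentre 𝒜))⟩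

@[simp] theorem fst_mul (x y : SuperAntiSum 𝒜) :
    (x * y).fst = x.fst * y.fst + x.snd * y.snd := rfl
@[simp] theorem snd_mul (x y : SuperAntiSum 𝒜) :
    (x * y).snd = x.fst * y.snd + x.snd * y.fst := rfl
@[simp] theorem fst_one : (1 : SuperAntiSum 𝒜).fst = 1 := rfl
@[simp] theorem snd_one : (1 : SuperAntiSum 𝒜).snd = 0 := rfl
@[simp] theorem fst_zero : (0 : SuperAntiSum 𝒜).fst = 0 := rfl
@[simp] theorem snd_zero : (0 : SuperAntiSum 𝒜).snd = 0 := rfl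
@[simp] theorem fst_add (x y : SuperAntiSum 𝒜) : (x + y).fst = x.fst + y.fst := rfl
@[simp] theorem snd_add (x y : SuperAntiSum 𝒜) : (x + y).snd = x.snd + y.snd := rfl
@[simp] theorem fst_smul (c : k) (x : SuperAntiSum 𝒜) : (c • x).fst = c • x.fst := rfl
@[simp] theorem snd_smul (c : k) (x : SuperAntiSum 𝒜) : (c • x).snd = c • x.snd := rfl

instance : Ring (SuperAntiSum 𝒜) where
  __ := (inferInstance : AddCommGroup (SuperAntiSum 𝒜))
  left_distrib x y z := by ext <;> simp [mul_add] <;> abel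
  right_distrib x y z := by ext <;> simp [add_mul] <;> abel
  zero_mul x := by ext <;> simp
  mul_zero x := by ext <;> simp
  mul_assoc x y z := by ext <;> simp [mul_add, add_mul, mul_assoc] <;> abel
  one_mul x := by ext <;> simp
  mul_one x := by ext <;> simp

instance : Algebra k (SuperAntiSum 𝒜) :=
  Algebra.ofModule (fun c x y => by ext <;> simp [smul_add])
    (fun c x y => by ext <;> simp [smul_add])

end SuperAntiSum

end Centre
/-- A finite-dimensional `ℤ/2`-graded left module (a supermodule) over the superalgebra `A`
with homogeneous components `𝒜 0` and `𝒜 1`. -/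
structure SuperMod {k A : Type u} [Field k] [Ring A] [Algebra k A]
    (𝒜 : ZMod 2 → Submodule k A) where
  carrier : Type u
  [addCommGroup : AddCommGroup carrier]
  [moduleBase : Module k carrier]
  [module : Module A carrier]
  [isScalarTower : IsScalarTower k A carrier]
  [finite : Module.Finite k carrier]
  /-- the homogeneous components -/
  gr : ZMod 2 → Submodule k carrier
  isInternal : DirectSum.IsInternal gr
  smul_mem : ∀ {i j : ZMod 2} {a : A} {v : carrier}, a ∈ 𝒜 i → v ∈ gr j → a • v ∈ gr (i + j)

namespace SuperMod

attribute [instance] addCommGroup moduleBase module isScalarTower finite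

section
variable {k A : Type u} [Field k] [Ring A] [Algebra k A] {𝒜 : ZMod 2 → Submodule k A}

theorem zmod_two : ∀ i : ZMod 2, i = 0 ∨ i = 1 := by decide

theorem isInternal_iff {V : Type u} [AddCommGroup V] [Module k V] (gr : ZMod 2 → Submodule k V) :
    DirectSum.IsInternal gr ↔ IsCompl (gr 0) (gr 1) :=
  DirectSum.isInternal_submodule_iff_isCompl gr (by decide) (by ext x; revert x; decide)

theorem exists_add (M : SuperMod 𝒜) (x : M.carrier) :
    ∃ a ∈ M.gr 0, ∃ b ∈ M.gr 1, a + b = x := by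
  have h := ((isInternal_iff _).1 M.isInternal).sup_eq_top
  exact Submodule.mem_sup.1 (h ▸ Submodule.mem_top (x := x))

theorem eq_zero (M : SuperMod 𝒜) {a : M.carrier} (h0 : a ∈ M.gr 0) (h1 : a ∈ M.gr 1) : a = 0 :=
  Submodule.disjoint_def.1 ((isInternal_iff _).1 M.isInternal).disjoint a h0 h1

theorem eq_of_add_eq (M : SuperMod 𝒜) {a b a' b' : M.carrier} (ha : a ∈ M.gr 0)
    (hb : b ∈ M.gr 1) (ha' : a' ∈ M.gr 0) (hb' : b' ∈ M.gr 1) (h : a + b = a' + b') :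
    a = a' ∧ b = b' := by
  have e : a - a' = b' - b := by
    rw [sub_eq_sub_iff_add_eq_add, h, add_comm]
  have h1 : a - a' = 0 :=
    M.eq_zero (sub_mem ha ha') (e ▸ sub_mem hb' hb)
  have h2 : b' - b = 0 := e ▸ h1
  exact ⟨sub_eq_zero.1 h1, (sub_eq_zero.1 h2).symm⟩

/-- Morphisms of supermodules: `A`-linear maps which preserve the grading. -/
@[ext]
structure Hom (M N : SuperMod 𝒜) where
  lin : M.carrier →ₗ[A] N.carrier
  map_mem : ∀ (i : ZMod 2) (v : M.carrier), v ∈ M.gr i → lin v ∈ N.gr i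

instance : Category (SuperMod 𝒜) where
  Hom M N := Hom M N
  id M := ⟨LinearMap.id, fun _ _ h => h⟩
  comp f g := ⟨g.lin ∘ₗ f.lin, fun i v h => g.map_mem i _ (f.map_mem i v h)⟩

/-- The linear map underlying a morphism of supermodules. -/
def lin {M N : SuperMod 𝒜} (f : M ⟶ N) : M.carrier →ₗ[A] N.carrier := Hom.lin f

theorem lin_mem {M N : SuperMod 𝒜} (f : M ⟶ N) {i : ZMod 2} {v : M.carrier} (h : v ∈ M.gr i) :
    lin f v ∈ N.gr i := Hom.map_mem f i v h

/-- Constructor for morphisms of supermodules. -/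
def mk' {M N : SuperMod 𝒜} (f : M.carrier →ₗ[A] N.carrier)
    (h : ∀ (i : ZMod 2) (v : M.carrier), v ∈ M.gr i → f v ∈ N.gr i) : M ⟶ N := Hom.mk f h

@[simp] theorem lin_mk' {M N : SuperMod 𝒜} (f : M.carrier →ₗ[A] N.carrier)
    (h : ∀ (i : ZMod 2) (v : M.carrier), v ∈ M.gr i → f v ∈ N.gr i) : lin (mk' f h) = f := rfl

@[simp] theorem lin_id (M : SuperMod 𝒜) : lin (𝟙 M) = LinearMap.id := rfl

@[simp] theorem lin_comp {M N P : SuperMod 𝒜} (f : M ⟶ N) (g : N ⟶ P) :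
    lin (f ≫ g) = lin g ∘ₗ lin f := rfl

theorem lin_injective {M N : SuperMod 𝒜} : Function.Injective (lin : (M ⟶ N) → _) :=
  fun _ _ h => Hom.ext h

theorem hom_ext {M N : SuperMod 𝒜} {f g : M ⟶ N} (h : ∀ x, lin f x = lin g x) : f = g :=
  lin_injective (LinearMap.ext h)

instance (M N : SuperMod 𝒜) : Zero (M ⟶ N) := ⟨mk' 0 fun i _ _ => (N.gr i).zero_mem⟩
instance (M N : SuperMod 𝒜) : Add (M ⟶ N) :=
  ⟨fun f g => mk' (lin f + lin g) fun i _ h => (N.gr i).add_mem (lin_mem f h) (lin_mem g h)⟩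
instance (M N : SuperMod 𝒜) : Neg (M ⟶ N) :=
  ⟨fun f => mk' (-lin f) fun i _ h => (N.gr i).neg_mem (lin_mem f h)⟩
instance (M N : SuperMod 𝒜) : Sub (M ⟶ N) :=
  ⟨fun f g => mk' (lin f - lin g) fun i _ h => (N.gr i).sub_mem (lin_mem f h) (lin_mem g h)⟩
instance (M N : SuperMod 𝒜) : SMul k (M ⟶ N) :=
  ⟨fun c f => mk' (c • lin f) fun i _ h => (N.gr i).smul_mem c (lin_mem f h)⟩
instance (M N : SuperMod 𝒜) : SMul ℕ (M ⟶ N) :=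
  ⟨fun c f => mk' (c • lin f) fun _ _ h => nsmul_mem (lin_mem f h) c⟩
instance (M N : SuperMod 𝒜) : SMul ℤ (M ⟶ N) :=
  ⟨fun c f => mk' (c • lin f) fun _ _ h => zsmul_mem (lin_mem f h) c⟩

instance (M N : SuperMod 𝒜) : AddCommGroup (M ⟶ N) :=
  lin_injective.addCommGroup _ rfl (fun _ _ => rfl) (fun _ => rfl) (fun _ _ => rfl)
    (fun _ _ => rfl) (fun _ _ => rfl)

@[simp] theorem lin_zero (M N : SuperMod 𝒜) : lin (0 : M ⟶ N) = 0 := rfl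
@[simp] theorem lin_add {M N : SuperMod 𝒜} (f g : M ⟶ N) : lin (f + g) = lin f + lin g := rfl
@[simp] theorem lin_sub {M N : SuperMod 𝒜} (f g : M ⟶ N) : lin (f - g) = lin f - lin g := rfl
@[simp] theorem lin_smul {M N : SuperMod 𝒜} (c : k) (f : M ⟶ N) : lin (c • f) = c • lin f := rfl

instance (M N : SuperMod 𝒜) : Module k (M ⟶ N) :=
  lin_injective.module k (AddMonoidHom.mk' lin (lin_add (M := M) (N := N))) (fun _ _ => rfl)

instance : Preadditive (SuperMod 𝒜) where
  add_comp _ _ _ f f' g := hom_ext fun x => by simp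
  comp_add _ _ _ f g g' := hom_ext fun x => by simp

instance : Linear k (SuperMod 𝒜) where
  smul_comp _ _ _ c f g := hom_ext fun x => by simp [LinearMap.map_smul_of_tower]
  comp_smul _ _ _ f c g := hom_ext fun x => rfl

/-- A submodule is homogeneous if it contains the homogeneous components of its elements. -/
def IsHomog (M : SuperMod 𝒜) (S : Submodule A M.carrier) : Prop :=
  ∀ a ∈ M.gr 0, ∀ b ∈ M.gr 1, a + b ∈ S → a ∈ S ∧ b ∈ S

/-- The supermodule given by a homogeneous submodule. -/
def sub (M : SuperMod 𝒜) (S : Submodule A M.carrier) (hS : M.IsHomog S) : SuperMod 𝒜 where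
  carrier := S
  finite := inferInstanceAs (Module.Finite k (S.restrictScalars k))
  gr i := (M.gr i).comap (S.subtype.restrictScalars k)
  isInternal := by
    rw [isInternal_iff]
    refine ⟨?_, ?_⟩
    · rw [Submodule.disjoint_def]
      intro x h0 h1
      exact Subtype.ext (M.eq_zero h0 h1)
    · rw [codisjoint_iff, eq_top_iff]
      rintro ⟨x, hx⟩ -
      obtain ⟨a, ha, b, hb, rfl⟩ := M.exists_add x
      exact Submodule.mem_sup.2 ⟨⟨a, (hS a ha b hb hx).1⟩, ha, ⟨b, (hS a ha b hb hx).2⟩, hb, rfl⟩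
  smul_mem ha hv := M.smul_mem ha hv

/-- The supermodule given by the quotient by a homogeneous submodule. -/
def quot (M : SuperMod 𝒜) (S : Submodule A M.carrier) (hS : M.IsHomog S) : SuperMod 𝒜 where
  carrier := M.carrier ⧸ S
  finite := Module.Finite.of_surjective (S.mkQ.restrictScalars k) S.mkQ_surjective
  gr i := (M.gr i).map (S.mkQ.restrictScalars k)
  isInternal := by
    rw [isInternal_iff]
    refine ⟨?_, ?_⟩
    · rw [Submodule.disjoint_def]
      rintro _ ⟨a, ha, rfl⟩ ⟨b, hb, hab⟩
      have h : a - b ∈ S := (Submodule.Quotient.eq S).1 hab.symm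
      rw [sub_eq_add_neg] at h
      exact (Submodule.Quotient.mk_eq_zero S).2 (hS a ha _ (neg_mem hb) h).1
    · rw [codisjoint_iff, eq_top_iff]
      intro x _
      obtain ⟨x, rfl⟩ := S.mkQ_surjective x
      obtain ⟨a, ha, b, hb, rfl⟩ := M.exists_add x
      exact Submodule.mem_sup.2 ⟨_, ⟨a, ha, rfl⟩, _, ⟨b, hb, rfl⟩, (map_add S.mkQ a b).symm⟩
  smul_mem := by
    rintro i j a _ ha ⟨v, hv, rfl⟩
    exact ⟨a • v, M.smul_mem ha hv, map_smul S.mkQ a v⟩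

theorem isHomog_ker {M N : SuperMod 𝒜} (f : M ⟶ N) : M.IsHomog (LinearMap.ker (lin f)) := by
  intro a ha b hb h
  rw [LinearMap.mem_ker, map_add] at h
  have := N.eq_of_add_eq (lin_mem f ha) (lin_mem f hb) (zero_mem _) (zero_mem _)
    (h.trans (add_zero 0).symm)
  exact this

theorem isHomog_range {M N : SuperMod 𝒜} (f : M ⟶ N) : N.IsHomog (LinearMap.range (lin f)) := by
  rintro a ha b hb ⟨x, hx⟩
  obtain ⟨c, hc, d, hd, rfl⟩ := M.exists_add x
  rw [map_add] at hx
  have := N.eq_of_add_eq (lin_mem f hc) (lin_mem f hd) ha hb hx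
  exact ⟨⟨c, this.1⟩, ⟨d, this.2⟩⟩

/-- The inclusion of a homogeneous submodule. -/
def subι (M : SuperMod 𝒜) (S : Submodule A M.carrier) (hS : M.IsHomog S) : M.sub S hS ⟶ M :=
  mk' S.subtype fun _ _ h => h

/-- The projection to the quotient by a homogeneous submodule. -/
def quotπ (M : SuperMod 𝒜) (S : Submodule A M.carrier) (hS : M.IsHomog S) : M ⟶ M.quot S hS :=
  mk' S.mkQ fun _ v h => ⟨v, h, rfl⟩

/-- The universal property of the kernel. -/
def kerIsLimit {M N : SuperMod 𝒜} (f : M ⟶ N) :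
    IsLimit (KernelFork.ofι (f := f) (M.subι _ (isHomog_ker f))
      (hom_ext fun x => x.2)) :=
  KernelFork.IsLimit.ofι _ _
    (fun g hg => mk' ((lin g).codRestrict _ fun x => congrArg (fun h => lin h x) hg)
      fun _ _ h => lin_mem g h)
    (fun _ _ => rfl)
    (fun _ _ _ hm => hom_ext fun x => Subtype.ext (congrArg (fun h => lin h x) hm))

/-- The universal property of the cokernel. -/
def cokerIsColimit {M N : SuperMod 𝒜} (f : M ⟶ N) :
    IsColimit (CokernelCofork.ofπ (f := f) (N.quotπ _ (isHomog_range f))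
      (hom_ext fun x => (Submodule.Quotient.mk_eq_zero _).2 ⟨x, rfl⟩)) :=
  CokernelCofork.IsColimit.ofπ _ _
    (fun g hg => mk' (Submodule.liftQ _ (lin g) (by
        rintro _ ⟨x, rfl⟩
        exact congrArg (fun h => lin h x) hg))
      (by rintro i _ ⟨v, hv, rfl⟩; exact lin_mem g hv))
    (fun _ _ => rfl)
    (fun _ _ _ hm => hom_ext fun x => by
      obtain ⟨x, rfl⟩ := Submodule.mkQ_surjective _ x
      exact congrArg (fun h => lin h x) hm)

instance : HasKernels (SuperMod 𝒜) where
  has_limit f := ⟨⟨_, kerIsLimit f⟩⟩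

instance : HasCokernels (SuperMod 𝒜) where
  has_colimit f := ⟨⟨_, cokerIsColimit f⟩⟩

theorem injective_of_mono {M N : SuperMod 𝒜} (f : M ⟶ N) [Mono f] :
    Function.Injective (lin f) := by
  rw [← LinearMap.ker_eq_bot, eq_bot_iff]
  intro x hx
  have h : M.subι _ (isHomog_ker f) = 0 := by
    rw [← cancel_mono f, zero_comp]
    exact hom_ext fun x => x.2
  exact congrArg (fun g => lin g (⟨x, hx⟩ : LinearMap.ker (lin f))) h

theorem surjective_of_epi {M N : SuperMod 𝒜} (f : M ⟶ N) [Epi f] :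
    Function.Surjective (lin f) := by
  intro y
  have h : N.quotπ _ (isHomog_range f) = 0 := by
    rw [← cancel_epi f, comp_zero]
    exact hom_ext fun x => (Submodule.Quotient.mk_eq_zero _).2 ⟨x, rfl⟩
  exact (Submodule.Quotient.mk_eq_zero _).1 (congrArg (fun g => lin g y) h)

/-- A monomorphism is the kernel of its cokernel. -/
@[reducible]
noncomputable def normalMono {M N : SuperMod 𝒜} (f : M ⟶ N) [Mono f] : NormalMono f where
  Z := N.quot _ (isHomog_range f)
  g := N.quotπ _ (isHomog_range f)
  w := hom_ext fun x => (Submodule.Quotient.mk_eq_zero _).2 ⟨x, rfl⟩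
  isLimit := KernelFork.IsLimit.ofι _ _
    (fun {W} g hg =>
      have hr (x : W.carrier) : lin g x ∈ LinearMap.range (lin f) :=
        (Submodule.Quotient.mk_eq_zero _).1 (congrArg (fun h => lin h x) hg)
      let φ : W.carrier →ₗ[A] M.carrier :=
        (LinearEquiv.ofInjective (lin f) (injective_of_mono f)).symm.toLinearMap ∘ₗ
          (lin g).codRestrict _ hr
      have hφ (x : W.carrier) : lin f (φ x) = lin g x :=
        congrArg Subtype.val
          ((LinearEquiv.ofInjective (lin f) (injective_of_mono f)).apply_symm_apply ⟨_, hr x⟩)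
      mk' φ fun i v hv => by
        obtain ⟨a, ha, b, hb, hab⟩ := M.exists_add (φ v)
        have h : lin f a + lin f b = lin g v := by rw [← map_add, hab, hφ]
        have hgv := lin_mem g hv
        have hi := zmod_two i
        rcases hi with rfl | rfl
        · have := (N.eq_of_add_eq (lin_mem f ha) (lin_mem f hb) hgv (zero_mem _)
            (h.trans (add_zero _).symm)).2
          rw [← hab, injective_of_mono f (this.trans (map_zero _).symm), add_zero]
          exact ha
        · have := (N.eq_of_add_eq (lin_mem f ha) (lin_mem f hb) (zero_mem _) hgv
            (h.trans (zero_add _).symm)).1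
          rw [← hab, injective_of_mono f (this.trans (map_zero _).symm), zero_add]
          exact hb)
    (fun {W} g hg => hom_ext fun x => congrArg Subtype.val
          ((LinearEquiv.ofInjective (lin f) (injective_of_mono f)).apply_symm_apply
            ⟨lin g x, (Submodule.Quotient.mk_eq_zero _).1 (congrArg (fun h => lin h x) hg)⟩))
    (fun g hg m hm => by
      rw [← cancel_mono f, hm]
      exact hom_ext fun x => (congrArg Subtype.val
          ((LinearEquiv.ofInjective (lin f) (injective_of_mono f)).apply_symm_apply
            ⟨lin g x, (Submodule.Quotient.mk_eq_zero _).1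
              (congrArg (fun h => lin h x) hg)⟩)).symm)

theorem ker_le {M N W : SuperMod 𝒜} {f : M ⟶ N} {g : M ⟶ W}
    (hg : M.subι _ (isHomog_ker f) ≫ g = 0) : LinearMap.ker (lin f) ≤ LinearMap.ker (lin g) := by
  intro x hx
  exact congrArg (fun h : M.sub _ (isHomog_ker f) ⟶ W =>
    lin h (⟨x, hx⟩ : LinearMap.ker (lin f))) hg

/-- An epimorphism is the cokernel of its kernel. -/
@[reducible]
noncomputable def normalEpi {M N : SuperMod 𝒜} (f : M ⟶ N) [Epi f] : NormalEpi f where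
  W := M.sub _ (isHomog_ker f)
  g := M.subι _ (isHomog_ker f)
  w := hom_ext fun x => x.2
  isColimit := CokernelCofork.IsColimit.ofπ _ _
    (fun {W} g hg =>
      have hk : LinearMap.ker (lin f) ≤ LinearMap.ker (lin g) := ker_le hg
      let e := (lin f).quotKerEquivOfSurjective (surjective_of_epi f)
      let φ : N.carrier →ₗ[A] W.carrier :=
        (Submodule.liftQ _ (lin g) hk) ∘ₗ e.symm.toLinearMap
      have hφ (x : M.carrier) : φ (lin f x) = lin g x := by
        have : e.symm (lin f x) = Submodule.Quotient.mk x := by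
          rw [LinearEquiv.symm_apply_eq]; rfl
        change Submodule.liftQ _ (lin g) hk (e.symm (lin f x)) = _
        rw [this]; rfl
      mk' φ fun i v hv => by
        obtain ⟨x, rfl⟩ := surjective_of_epi f v
        obtain ⟨a, ha, b, hb, rfl⟩ := M.exists_add x
        rw [map_add] at hv
        have hi := zmod_two i
        rcases hi with rfl | rfl
        · have := (N.eq_of_add_eq (lin_mem f ha) (lin_mem f hb) hv (zero_mem _)
            (add_zero _).symm).2
          rw [map_add, this, add_zero, hφ]
          exact lin_mem g ha
        · have := (N.eq_of_add_eq (lin_mem f ha) (lin_mem f hb) (zero_mem _) hv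
            (zero_add _).symm).1
          rw [map_add, this, zero_add, hφ]
          exact lin_mem g hb)
    (fun {W} g hg => hom_ext fun x => by
      have hk : LinearMap.ker (lin f) ≤ LinearMap.ker (lin g) := ker_le hg
      have : ((lin f).quotKerEquivOfSurjective (surjective_of_epi f)).symm (lin f x) =
          Submodule.Quotient.mk x := by
        rw [LinearEquiv.symm_apply_eq]; rfl
      change Submodule.liftQ _ (lin g) hk
        (((lin f).quotKerEquivOfSurjective (surjective_of_epi f)).symm (lin f x)) = _
      rw [this]; rfl)
    (fun {W} g hg m hm => by
      rw [← cancel_epi f, hm]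
      refine hom_ext fun x => ?_
      have hk : LinearMap.ker (lin f) ≤ LinearMap.ker (lin g) := ker_le hg
      have : ((lin f).quotKerEquivOfSurjective (surjective_of_epi f)).symm (lin f x) =
          Submodule.Quotient.mk x := by
        rw [LinearEquiv.symm_apply_eq]; rfl
      change _ = Submodule.liftQ _ (lin g) hk
        (((lin f).quotKerEquivOfSurjective (surjective_of_epi f)).symm (lin f x))
      rw [this]; rfl)

/-- The direct sum of two supermodules. -/
def prod (M N : SuperMod 𝒜) : SuperMod 𝒜 where
  carrier := M.carrier × N.carrier
  gr i := (M.gr i).prod (N.gr i)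
  isInternal := by
    rw [isInternal_iff]
    refine ⟨?_, ?_⟩
    · rw [Submodule.disjoint_def]
      intro x h0 h1
      exact Prod.ext (M.eq_zero h0.1 h1.1) (N.eq_zero h0.2 h1.2)
    · rw [codisjoint_iff, eq_top_iff]
      rintro ⟨x, y⟩ -
      obtain ⟨a, ha, b, hb, rfl⟩ := M.exists_add x
      obtain ⟨c, hc, d, hd, rfl⟩ := N.exists_add y
      exact Submodule.mem_sup.2 ⟨(a, c), ⟨ha, hc⟩, (b, d), ⟨hb, hd⟩, rfl⟩
  smul_mem ha hv := ⟨M.smul_mem ha hv.1, N.smul_mem ha hv.2⟩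

/-- The direct sum as a bicone. -/
def prodBicone (M N : SuperMod 𝒜) : BinaryBicone M N where
  pt := M.prod N
  fst := mk' (LinearMap.fst A _ _) fun _ _ h => h.1
  snd := mk' (LinearMap.snd A _ _) fun _ _ h => h.2
  inl := mk' (LinearMap.inl A _ _) fun _ _ h => ⟨h, zero_mem _⟩
  inr := mk' (LinearMap.inr A _ _) fun _ _ h => ⟨zero_mem _, h⟩
  inl_fst := rfl
  inl_snd := rfl
  inr_fst := rfl
  inr_snd := rfl

instance : HasBinaryBiproducts (SuperMod 𝒜) where
  has_binary_biproduct M N := HasBinaryBiproduct.mk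
    ⟨prodBicone M N, isBinaryBilimitOfTotal _ (hom_ext fun x =>
      Prod.ext (add_zero x.1) (zero_add x.2))⟩

/-- The zero supermodule. -/
def zeroObj (𝒜 : ZMod 2 → Submodule k A) : SuperMod 𝒜 where
  carrier := PUnit
  gr _ := ⊤
  isInternal := by
    rw [isInternal_iff]
    exact ⟨Submodule.disjoint_def.2 fun _ _ _ => rfl, codisjoint_top_left⟩
  smul_mem _ _ := trivial

instance : HasZeroObject (SuperMod 𝒜) :=
  ⟨zeroObj 𝒜, (IsZero.iff_id_eq_zero _).2 (hom_ext fun _ => rfl)⟩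

instance : HasFiniteProducts (SuperMod 𝒜) :=
  hasFiniteProducts_of_has_binary_and_terminal

/-- Supermodules form an abelian category. -/
noncomputable instance : Abelian (SuperMod 𝒜) where
  normalMonoOfMono f _ := ⟨normalMono f⟩
  normalEpiOfEpi f _ := ⟨normalEpi f⟩

/-- The parity shift functor `Π`: it keeps the underlying modules and maps, and
`(Π M)_i = M_{i+1}`. -/
def parityShift (𝒜 : ZMod 2 → Submodule k A) : SuperMod 𝒜 ⥤ SuperMod 𝒜 where
  obj M :=
    { carrier := M.carrier
      gr := fun i => M.gr (i + 1)
      isInternal := by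
        rw [isInternal_iff]
        exact ((isInternal_iff _).1 M.isInternal).symm
      smul_mem := fun {i j a v} ha hv => by
        rw [add_assoc]
        exact M.smul_mem ha hv }
  map {M N} f := mk' (lin (M := M) (N := N) f) fun _ _ h => lin_mem (M := M) (N := N) f h
  map_id _ := rfl
  map_comp _ _ := rfl

theorem add_one_one : ∀ i : ZMod 2, i + 1 + 1 = i := by decide

/-- The identification `Π² = Id`, given by identity maps. -/
def piPi (𝒜 : ZMod 2 → Submodule k A) : parityShift 𝒜 ⋙ parityShift 𝒜 ≅ 𝟭 (SuperMod 𝒜) :=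
  NatIso.ofComponents (fun M =>
    { hom := mk' (M := (parityShift 𝒜).obj ((parityShift 𝒜).obj M)) (N := M) LinearMap.id
        fun i v h => add_one_one i ▸ (show v ∈ M.gr (i + 1 + 1) from h)
      inv := mk' (M := M) (N := (parityShift 𝒜).obj ((parityShift 𝒜).obj M)) LinearMap.id
        fun i v h => show v ∈ M.gr (i + 1 + 1) from (add_one_one i).symm ▸ h
      hom_inv_id := rfl
      inv_hom_id := rfl })
    (fun _ => lin_injective rfl)

instance : (parityShift 𝒜).Additive where
  map_add := lin_injective rfl

instance : (parityShift 𝒜).Linear k where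
  map_smul _ _ := lin_injective rfl

instance : (parityShift 𝒜).IsEquivalence :=
  (CategoryTheory.Equivalence.mk (parityShift 𝒜) (parityShift 𝒜) (piPi 𝒜).symm (piPi 𝒜)).isEquivalence_functor

/-- The left regular supermodule of a finite-dimensional superalgebra. -/
def regular (𝒜 : ZMod 2 → Submodule k A) [GradedAlgebra 𝒜] [Module.Finite k A] :
    SuperMod 𝒜 where
  carrier := A
  gr := 𝒜
  isInternal := DirectSum.Decomposition.isInternal 𝒜
  smul_mem ha hv := SetLike.mul_mem_graded ha hv

/-- A fixed model of the (unbounded) derived category of supermodules. -/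
noncomputable instance : HasDerivedCategory.{u + 1} (SuperMod 𝒜) :=
  HasDerivedCategory.standard _

/-- The functor induced by `Π` on complexes. -/
noncomputable abbrev piComplex (𝒜 : ZMod 2 → Submodule k A) :
    CochainComplex (SuperMod 𝒜) ℤ ⥤ CochainComplex (SuperMod 𝒜) ℤ :=
  (parityShift 𝒜).mapHomologicalComplex (ComplexShape.up ℤ)

/-- `Π² = Id` on complexes. -/
noncomputable def piPiComplex (𝒜 : ZMod 2 → Submodule k A) :
    piComplex 𝒜 ⋙ piComplex 𝒜 ≅ 𝟭 _ :=
  NatIso.mapHomologicalComplex (piPi 𝒜) (ComplexShape.up ℤ) ≪≫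
    Functor.mapHomologicalComplexIdIso _ _

/-- The functor induced by the exact functor `Π` on the derived category. -/
noncomputable abbrev piDerived (𝒜 : ZMod 2 → Submodule k A) :
    DerivedCategory (SuperMod 𝒜) ⥤ DerivedCategory (SuperMod 𝒜) :=
  (parityShift 𝒜).mapDerivedCategory

/-- `Π² = Id` on the derived category, induced by `Π² = Id` on complexes. -/
noncomputable def piPiDerived (𝒜 : ZMod 2 → Submodule k A) :
    piDerived 𝒜 ⋙ piDerived 𝒜 ≅ 𝟭 _ :=
  letI : Localization.Lifting DerivedCategory.Q
      (HomologicalComplex.quasiIso (SuperMod 𝒜) (ComplexShape.up ℤ))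
      (piComplex 𝒜 ⋙ piComplex 𝒜 ⋙ DerivedCategory.Q) (piDerived 𝒜 ⋙ piDerived 𝒜) :=
    ⟨(Functor.associator _ _ _).symm ≪≫
      Functor.isoWhiskerRight (parityShift 𝒜).mapDerivedCategoryFactors _ ≪≫
      Functor.associator _ _ _ ≪≫
      Functor.isoWhiskerLeft _ (parityShift 𝒜).mapDerivedCategoryFactors⟩
  letI : Localization.Lifting DerivedCategory.Q
      (HomologicalComplex.quasiIso (SuperMod 𝒜) (ComplexShape.up ℤ))
      DerivedCategory.Q (𝟭 (DerivedCategory (SuperMod 𝒜))) := ⟨Functor.rightUnitor _⟩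
  Localization.liftNatIso DerivedCategory.Q
    (HomologicalComplex.quasiIso (SuperMod 𝒜) (ComplexShape.up ℤ)) _ _ _ _
    ((Functor.associator _ _ _).symm ≪≫
      Functor.isoWhiskerRight (piPiComplex 𝒜) DerivedCategory.Q ≪≫ Functor.leftUnitor _)

/-- On the image of a complex `K`, the isomorphism `piPiDerived` is the image of the
isomorphism `Π² K ≅ K` of complexes. -/
theorem piPiDerived_hom_app (𝒜 : ZMod 2 → Submodule k A) (K : CochainComplex (SuperMod 𝒜) ℤ) :
    (piPiDerived 𝒜).hom.app (DerivedCategory.Q.obj K) =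
      (piDerived 𝒜).map ((parityShift 𝒜).mapDerivedCategoryFactors.hom.app K) ≫
        (parityShift 𝒜).mapDerivedCategoryFactors.hom.app ((piComplex 𝒜).obj K) ≫
          DerivedCategory.Q.map ((piPiComplex 𝒜).hom.app K) := by
  simp [piPiDerived]

/-- The bounded derived category of finite-dimensional supermodules. -/
abbrev Db (𝒜 : ZMod 2 → Submodule k A) : Type (u + 1) := DerivedCategory.Bounded (SuperMod 𝒜)

theorem piDerived_bounded (𝒜 : ZMod 2 → Submodule k A) (X : DerivedCategory (SuperMod 𝒜))
    (hX : (DerivedCategory.TStructure.t).bounded X) :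
    (DerivedCategory.TStructure.t).bounded ((piDerived 𝒜).obj X) := by
  obtain ⟨⟨a, ⟨K, e, hK⟩⟩, ⟨b, ⟨L, e', hL⟩⟩⟩ := hX
  refine ⟨⟨a, ⟨(piComplex 𝒜).obj K,
      (piDerived 𝒜).mapIso e ≪≫ (parityShift 𝒜).mapDerivedCategoryFactors.app K, inferInstance⟩⟩,
    ⟨b, ⟨(piComplex 𝒜).obj L,
      (piDerived 𝒜).mapIso e' ≪≫ (parityShift 𝒜).mapDerivedCategoryFactors.app L, inferInstance⟩⟩⟩

/-- The parity shift functor on the bounded derived category. -/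
noncomputable def PiDb (𝒜 : ZMod 2 → Submodule k A) : Db 𝒜 ⥤ Db 𝒜 :=
  ObjectProperty.lift _ (DerivedCategory.Bounded.ι ⋙ piDerived 𝒜)
    fun X => piDerived_bounded 𝒜 X.obj X.property

/-- `Π² = Id` on the bounded derived category. -/
noncomputable def piPiDb (𝒜 : ZMod 2 → Submodule k A) : PiDb 𝒜 ⋙ PiDb 𝒜 ≅ 𝟭 (Db 𝒜) :=
  NatIso.ofComponents
    (fun X => ObjectProperty.isoMk _ ((piPiDerived 𝒜).app X.obj))
    (fun {X Y} f => by
      apply ObjectProperty.hom_ext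
      exact (piPiDerived 𝒜).hom.naturality f.hom)

/-- A supermodule, viewed as an object of the bounded derived category concentrated in
degree `n`. -/
noncomputable def single {𝒜 : ZMod 2 → Submodule k A} (n : ℤ) (M : SuperMod 𝒜) : Db 𝒜 :=
  ⟨(DerivedCategory.singleFunctor (SuperMod 𝒜) n).obj M, ⟨n, inferInstance⟩, ⟨n, inferInstance⟩⟩

end

/-! ### Triangulated `Π`-functors -/

section

variable {k A B : Type u} [Field k] [Ring A] [Algebra k A] [Ring B] [Algebra k B]

/-- A triangulated `Π`-functor between bounded derived categories of supermodules: a `k`-linear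
triangulated functor `F` with a natural isomorphism `ξ : Π ∘ F ⇒ F ∘ Π` such that
`ξ_Π ∘ Π(ξ) : Π² ∘ F ⇒ F ∘ Π²` is the identity of `F` under the identification `Π² = Id`. -/
structure PiFunctor (𝒜 : ZMod 2 → Submodule k A) (ℬ : ZMod 2 → Submodule k B) where
  F : Db 𝒜 ⥤ Db ℬ
  [linear : F.Linear k]
  [commShift : F.CommShift ℤ]
  [isTriangulated : F.IsTriangulated]
  ξ : F ⋙ PiDb ℬ ≅ PiDb 𝒜 ⋙ F
  ξ_comp : ∀ X : Db 𝒜,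
    (PiDb ℬ).map (ξ.hom.app X) ≫ ξ.hom.app ((PiDb 𝒜).obj X) ≫ F.map ((piPiDb 𝒜).hom.app X) =
      (piPiDb ℬ).hom.app (F.obj X)

/-- The functor sends the left regular supermodule to an object which is isomorphic to a
supermodule placed in a single cohomological degree. -/
def PiFunctor.IsStrong {𝒜 : ZMod 2 → Submodule k A} {ℬ : ZMod 2 → Submodule k B}
    [GradedAlgebra 𝒜] [Module.Finite k A] (Φ : PiFunctor 𝒜 ℬ) : Prop :=
  ∃ (n : ℤ) (T : SuperMod ℬ), Nonempty (Φ.F.obj (single 0 (regular 𝒜)) ≅ single n T)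

end

end SuperMod

/-! Let `T` be the supermodule which, placed in one degree, is the image of the regular supermodule
of `A`. Right multiplications identify `A`, with reversed product, with the even and odd
endomorphisms of its regular supermodule, and the equivalence carries these to the even and odd
endomorphisms of `T`. The coherence of `ξ` with `Π² = Id` makes the product of two odd endomorphisms
come out right, so the graded algebra of `B`-linear endomorphisms of `T` is `A` with reversed
product (`IsOppositeEnd`).

Treat both centres at once through the rule `z y = (-1)^{(∂z + c) ∂y} y z`, with `c = 0` for the
super centre and `c = 1` for the anti centre. If `z` in `B` obeys it, then `v ↦ (-1)^{(∂z + c) ∂v} z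
v` is a `B`-linear endomorphism of `T`, hence comes from an element of `A`. That element obeys the
same rule, because every endomorphism of `T` commutes with the action of `z`. This gives linear maps
from the twisted centres of `B` to those of `A`, compatible with all products (`exists_linearMap`).

Injectivity says that a `z` killing `T` is zero. Such a `z` defines a natural transformation `η`
from the identity to `H`, where `H` is the identity or `Π`, vanishing on `T` and `ΠT`. The
quasi-inverse sends `η` at the regular supermodule of `B` to a morphism between modules placed in
the same degree, which can be tested on `A` and `ΠA`. Under the equivalence these tests become
morphisms out of shifts of `T` and `ΠT`, and naturality of `η` in the derived category kills them
(`app_regular_eq_zero`).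

By symmetry there are injective algebra maps in both directions between finite-dimensional algebras,
so these are isomorphisms. -/

namespace SuperMod

/-! ### Supermodules in a single degree and the parity shift -/

variable {k A : Type u} [Field k] [Ring A] [Algebra k A] {𝒜 : ZMod 2 → Submodule k A}

/-- Placing a supermodule in degree `n`, as a functor to the bounded derived category. -/
noncomputable def singleDb (𝒜 : ZMod 2 → Submodule k A) (n : ℤ) : SuperMod 𝒜 ⥤ Db 𝒜 :=
  ObjectProperty.lift _ (DerivedCategory.singleFunctor (SuperMod 𝒜) n) fun M =>
    (single n M).property

instance (n : ℤ) : (singleDb 𝒜 n).Full where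
  map_surjective {M N} f := by
    obtain ⟨g, hg⟩ := (DerivedCategory.singleFunctor (SuperMod 𝒜) n).map_surjective
      (X := M) (Y := N) f.hom
    exact ⟨g, ObjectProperty.hom_ext _ hg⟩

instance (n : ℤ) : (singleDb 𝒜 n).Faithful where
  map_injective h := (DerivedCategory.singleFunctor (SuperMod 𝒜) n).map_injective
    (congrArg (fun f => f.hom) h)

instance (n : ℤ) : (singleDb 𝒜 n).Additive where
  map_add := ObjectProperty.hom_ext _ ((DerivedCategory.singleFunctor (SuperMod 𝒜) n).map_add)

instance (n : ℤ) : (singleDb 𝒜 n).Linear k where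
  map_smul f c := ObjectProperty.hom_ext _
    ((DerivedCategory.singleFunctor (SuperMod 𝒜) n).map_smul c f)

/-- Carries a `Π²` coherence from complexes to the localization: `φ` compares the two parity shifts,
and its naturality moves it past `Q.map a`. -/
theorem map_comp_factors {K D : Type*} [Category* K] [Category* D] {Q : K ⥤ D} {P : K ⥤ K}
    {P' : D ⥤ D} (φ : Q ⋙ P' ⟶ P ⋙ Q) {X Y Z W : K} (a : P.obj X ⟶ Y) (b : P.obj Y ⟶ Z)
    (c : Z ⟶ W) (d : P.obj (P.obj X) ⟶ W) (h : P.map a ≫ b ≫ c = d) :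
    P'.map (φ.app X ≫ Q.map a) ≫ (φ.app Y ≫ Q.map b) ≫ Q.map c =
      P'.map (φ.app X) ≫ φ.app (P.obj X) ≫ Q.map d := by
  have := φ.naturality a
  dsimp at this
  simp [← h, reassoc_of% this]

theorem map_comp_factors_naturality {K D : Type*} [Category* K] [Category* D] {Q : K ⥤ D}
    {P : K ⥤ K} {P' : D ⥤ D} (φ : Q ⋙ P' ⟶ P ⋙ Q) {X Y X' Y' : K} (f : X ⟶ Y) (a : P.obj X ⟶ X')
    (b : P.obj Y ⟶ Y') (g : X' ⟶ Y') (h : P.map f ≫ b = a ≫ g) :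
    P'.map (Q.map f) ≫ φ.app Y ≫ Q.map b = (φ.app X ≫ Q.map a) ≫ Q.map g := by
  have := φ.naturality f
  dsimp at this
  rw [reassoc_of% this, Category.assoc, ← Q.map_comp, ← Q.map_comp, h]

/-- The degree `n` term of a single complex is only isomorphic to the module it holds; these
comparison isomorphisms cancel by naturality of `e`. -/
theorem conj_app {C : Type*} [Category* C] {P : C ⥤ C} (e : P ⋙ P ⟶ 𝟭 C)
    {X X₀ X₁ X₂ : C} (u : X₀ ≅ X) (v : X₁ ≅ P.obj X) (w : X₂ ≅ P.obj (P.obj X)) :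
    P.map (P.map u.hom ≫ v.inv) ≫ (P.map v.hom ≫ w.inv) ≫ w.hom ≫ e.app X ≫ u.inv =
      e.app X₀ := by
  have := e.naturality u.hom
  dsimp at this
  simp [reassoc_of% this]

/-- Placing complexes in degree `n` commutes with the parity shift. -/
noncomputable def singlePi (𝒜 : ZMod 2 → Submodule k A) (n : ℤ) :
    HomologicalComplex.single (SuperMod 𝒜) (ComplexShape.up ℤ) n ⋙ piComplex 𝒜 ≅
      parityShift 𝒜 ⋙ HomologicalComplex.single (SuperMod 𝒜) (ComplexShape.up ℤ) n :=
  HomologicalComplex.singleMapHomologicalComplex (parityShift 𝒜) (ComplexShape.up ℤ) n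

theorem piPiComplex_hom_app_f (K : CochainComplex (SuperMod 𝒜) ℤ) (n : ℤ) :
    ((piPiComplex 𝒜).hom.app K).f n = (piPi 𝒜).hom.app (K.X n) :=
  Category.comp_id _

theorem singlePi_piPi (n : ℤ) (M : SuperMod 𝒜) :
    (piComplex 𝒜).map ((singlePi 𝒜 n).hom.app M) ≫
      (singlePi 𝒜 n).hom.app ((parityShift 𝒜).obj M) ≫
      (HomologicalComplex.single (SuperMod 𝒜) (ComplexShape.up ℤ) n).map ((piPi 𝒜).hom.app M) =
    (piPiComplex 𝒜).hom.app
      ((HomologicalComplex.single (SuperMod 𝒜) (ComplexShape.up ℤ) n).obj M) := by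
  apply HomologicalComplex.to_single_hom_ext
  rw [HomologicalComplex.comp_f, HomologicalComplex.comp_f, Functor.mapHomologicalComplex_map_f,
    piPiComplex_hom_app_f, singlePi,
    HomologicalComplex.singleMapHomologicalComplex_hom_app_self,
    HomologicalComplex.singleMapHomologicalComplex_hom_app_self,
    HomologicalComplex.single_map_f_self]
  exact conj_app (piPi 𝒜).hom (HomologicalComplex.singleObjXSelf (ComplexShape.up ℤ) n M)
    (HomologicalComplex.singleObjXSelf (ComplexShape.up ℤ) n ((parityShift 𝒜).obj M))
    (HomologicalComplex.singleObjXSelf (ComplexShape.up ℤ) n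
      ((parityShift 𝒜).obj ((parityShift 𝒜).obj M)))

/-- Placing supermodules in degree `n` commutes with the parity shift, in the derived category. -/
noncomputable def singleDerivedPi (𝒜 : ZMod 2 → Submodule k A) (n : ℤ) :
    (HomologicalComplex.single (SuperMod 𝒜) (ComplexShape.up ℤ) n ⋙ DerivedCategory.Q) ⋙
        piDerived 𝒜 ≅
      parityShift 𝒜 ⋙
        (HomologicalComplex.single (SuperMod 𝒜) (ComplexShape.up ℤ) n ⋙ DerivedCategory.Q) :=
  NatIso.ofComponents
    (fun M => (parityShift 𝒜).mapDerivedCategoryFactors.app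
        ((HomologicalComplex.single (SuperMod 𝒜) (ComplexShape.up ℤ) n).obj M) ≪≫
      DerivedCategory.Q.mapIso ((singlePi 𝒜 n).app M))
    (fun f => map_comp_factors_naturality (parityShift 𝒜).mapDerivedCategoryFactors.hom _ _ _ _
      ((singlePi 𝒜 n).hom.naturality f))

/-- Placing supermodules in degree `n` commutes with the parity shift. -/
noncomputable def singleDbPi (𝒜 : ZMod 2 → Submodule k A) (n : ℤ) :
    singleDb 𝒜 n ⋙ PiDb 𝒜 ≅ parityShift 𝒜 ⋙ singleDb 𝒜 n :=
  NatIso.ofComponents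
    (fun M => ObjectProperty.isoMk _ ((singleDerivedPi 𝒜 n).app M))
    (fun f => ObjectProperty.hom_ext _ ((singleDerivedPi 𝒜 n).hom.naturality f))

/-- This has the shape of the coherence `ξ_comp`: placement in one degree itself respects `Π² = Id`.
It is needed to compare odd endomorphisms of modules with those in `Db`. -/
theorem singleDbPi_piPi (n : ℤ) (M : SuperMod 𝒜) :
    (PiDb 𝒜).map ((singleDbPi 𝒜 n).hom.app M) ≫
        (singleDbPi 𝒜 n).hom.app ((parityShift 𝒜).obj M) ≫
          (singleDb 𝒜 n).map ((piPi 𝒜).hom.app M) =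
      (piPiDb 𝒜).hom.app ((singleDb 𝒜 n).obj M) := by
  apply ObjectProperty.hom_ext
  refine Eq.trans ?_ (piPiDerived_hom_app 𝒜
    ((HomologicalComplex.single (SuperMod 𝒜) (ComplexShape.up ℤ) n).obj M)).symm
  exact map_comp_factors (parityShift 𝒜).mapDerivedCategoryFactors.hom
    _ _ _ _ (singlePi_piPi n M)

end SuperMod

/-! ### Natural transformations tested against morphisms of the derived category -/

section

variable {C : Type*} [Category* C] [Abelian C]

/-- The natural transformation on complexes induced by `𝟭 C ⟶ H`. -/
def complexMap {H : C ⥤ C} [H.Additive] (η : 𝟭 C ⟶ H) (K : CochainComplex C ℤ) :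
    K ⟶ (H.mapHomologicalComplex (ComplexShape.up ℤ)).obj K where
  f i := η.app (K.X i)
  comm' i j _ := (η.naturality (K.d i j)).symm

theorem complexMap_naturality {H : C ⥤ C} [H.Additive] (η : 𝟭 C ⟶ H)
    {K L : CochainComplex C ℤ} (f : K ⟶ L) :
    f ≫ complexMap η L =
      complexMap η K ≫ (H.mapHomologicalComplex (ComplexShape.up ℤ)).map f := by
  ext i
  exact η.naturality (f.f i)

/-- Both sides live in degree `n` only, where this is naturality of `η` along the comparison
isomorphism. -/
theorem complexMap_single {H : C ⥤ C} [H.Additive] (η : 𝟭 C ⟶ H) (n : ℤ) (M : C) :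
    (HomologicalComplex.single C (ComplexShape.up ℤ) n).map (η.app M) =
      complexMap η _ ≫
        (HomologicalComplex.singleMapHomologicalComplex H (ComplexShape.up ℤ) n).hom.app M := by
  apply HomologicalComplex.to_single_hom_ext
  have h := η.naturality (HomologicalComplex.singleObjXSelf (ComplexShape.up ℤ) n M).hom
  dsimp at h
  rw [HomologicalComplex.comp_f, HomologicalComplex.single_map_f_self,
    HomologicalComplex.singleMapHomologicalComplex_hom_app_self]
  simp only [Functor.id_obj, complexMap]
  rw [reassoc_of% h]
  rfl

theorem complexMap_single_eq_zero {H : C ⥤ C} [H.Additive] (η : 𝟭 C ⟶ H) (n : ℤ) {M : C}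
    (hM : η.app M = 0) :
    complexMap η ((HomologicalComplex.single C (ComplexShape.up ℤ) n).obj M) = 0 := by
  have h := complexMap_single η n M
  rw [hM, Functor.map_zero] at h
  rw [← cancel_mono
    ((HomologicalComplex.singleMapHomologicalComplex H (ComplexShape.up ℤ) n).hom.app M),
    ← h, zero_comp]

/-- Natural transformations from the identity to an exact functor are natural with respect to
morphisms of the derived category; in particular they are annihilated by morphisms whose source
is annihilated. -/
theorem comp_singleFunctor_map_eq_zero [HasDerivedCategory C] {H : C ⥤ C} [H.Additive]
    [PreservesFiniteLimits H] [PreservesFiniteColimits H] (η : 𝟭 C ⟶ H) {a b : ℤ} {M N : C}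
    (hM : η.app M = 0)
    (q : (DerivedCategory.singleFunctor C a).obj M ⟶ (DerivedCategory.singleFunctor C b).obj N) :
    q ≫ (DerivedCategory.singleFunctor C b).map (η.app N) = 0 := by
  -- Write `q` as a roof: the inverse of a quasi-isomorphism `s` out of `X`, followed by an honest
  -- map of complexes `g`.
  obtain ⟨X, s, hs, g, hq⟩ := DerivedCategory.right_fac
    (X := (HomologicalComplex.single C (ComplexShape.up ℤ) a).obj M)
    (Y := (HomologicalComplex.single C (ComplexShape.up ℤ) b).obj N) q
  have hs' := hs
  rw [DerivedCategory.isIso_Q_map_iff_quasiIso] at hs'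
  have : IsIso (DerivedCategory.Q.map ((H.mapHomologicalComplex (ComplexShape.up ℤ)).map s)) := by
    rw [DerivedCategory.isIso_Q_map_iff_quasiIso]
    infer_instance
  -- `η` on `X` followed by `H(s)` equals `s` followed by `η` on `M`, which is zero; exactness of
  -- `H` makes `H(s)` invertible after localization.
  have h0 : DerivedCategory.Q.map (complexMap η X) = 0 := by
    rw [← cancel_mono
      (DerivedCategory.Q.map ((H.mapHomologicalComplex (ComplexShape.up ℤ)).map s)),
      ← Functor.map_comp, ← complexMap_naturality, complexMap_single_eq_zero η a hM,
      comp_zero, Functor.map_zero, zero_comp]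
  have h1 : DerivedCategory.Q.map g ≫ DerivedCategory.Q.map
      ((HomologicalComplex.single C (ComplexShape.up ℤ) b).map (η.app N)) = 0 := by
    rw [complexMap_single, ← Functor.map_comp, ← Category.assoc, complexMap_naturality,
      Functor.map_comp, Functor.map_comp, h0, zero_comp, zero_comp]
  have h2 : q ≫ DerivedCategory.Q.map
      ((HomologicalComplex.single C (ComplexShape.up ℤ) b).map (η.app N)) = 0 := by
    rw [hq]
    erw [Category.assoc, h1, comp_zero]
  exact h2

end

/-! ### Images of single-degree objects under Π-functors -/

namespace SuperMod

variable {k A : Type u} [Field k] [Ring A] [Algebra k A] {𝒜 : ZMod 2 → Submodule k A}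

theorem singleDb_shift (M : SuperMod 𝒜) {n a a' : ℤ} (h : n + a = a') :
    Nonempty (((singleDb 𝒜 a').obj M)⟦n⟧ ≅ (singleDb 𝒜 a).obj M) :=
  ⟨DerivedCategory.Bounded.ι.preimageIso ((DerivedCategory.Bounded.ι.commShiftIso n).app _ ≪≫
    ((DerivedCategory.singleFunctors (SuperMod 𝒜)).shiftIso n a a' h).app M)⟩

variable {B : Type u} [Ring B] [Algebra k B] {ℬ : ZMod 2 → Submodule k B}

/-- Commutation with the triangulated shift propagates the information from degree `0` to every
degree `m`. -/
theorem PiFunctor.singleDb_iso (Φ : PiFunctor 𝒜 ℬ) {M : SuperMod 𝒜} {N : SuperMod ℬ} {n : ℤ}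
    (e : Φ.F.obj ((singleDb 𝒜 0).obj M) ≅ (singleDb ℬ n).obj N) (m : ℤ) :
    Nonempty (Φ.F.obj ((singleDb 𝒜 m).obj M) ≅ (singleDb ℬ (n + m)).obj N) := by
  obtain ⟨e₁⟩ := singleDb_shift M (n := -m) (a := m) (a' := 0) (by simp)
  obtain ⟨e₂⟩ := singleDb_shift N (n := -m) (a := n + m) (a' := n) (by simp)
  let := Φ.commShift
  exact ⟨Φ.F.mapIso e₁.symm ≪≫ (Φ.F.commShiftIso (-m)).app _ ≪≫
    (shiftFunctor _ (-m)).mapIso e ≪≫ e₂⟩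

theorem PiFunctor.singleDb_parityShift_iso (Φ : PiFunctor 𝒜 ℬ) {M : SuperMod 𝒜}
    {N : SuperMod ℬ} {n m : ℤ} (e : Φ.F.obj ((singleDb 𝒜 m).obj M) ≅ (singleDb ℬ n).obj N) :
    Nonempty (Φ.F.obj ((singleDb 𝒜 m).obj ((parityShift 𝒜).obj M)) ≅
      (singleDb ℬ n).obj ((parityShift ℬ).obj N)) :=
  ⟨Φ.F.mapIso ((singleDbPi 𝒜 m).app M).symm ≪≫ (Φ.ξ.app _).symm ≪≫ (PiDb ℬ).mapIso e ≪≫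
    (singleDbPi ℬ n).app N⟩

end SuperMod

/-! ### Generation by the regular supermodule and detection of zero -/

namespace SuperMod
variable {k A : Type u} [Field k] [Ring A] [Algebra k A] {𝒜 : ZMod 2 → Submodule k A}

section

variable [GradedAlgebra 𝒜] [Module.Finite k A]

/-- The morphism from the regular supermodule given by an even element. -/
def ofEven (M : SuperMod 𝒜) (m : M.carrier) (hm : m ∈ M.gr 0) : regular 𝒜 ⟶ M :=
  mk' (M := regular 𝒜) (LinearMap.toSpanSingleton A M.carrier m)
    fun i a ha => add_zero i ▸ M.smul_mem (a := a) ha hm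

/-- The morphism from the shifted regular supermodule given by an odd element. -/
def ofOdd (M : SuperMod 𝒜) (m : M.carrier) (hm : m ∈ M.gr 1) :
    (parityShift 𝒜).obj (regular 𝒜) ⟶ M :=
  mk' (M := (parityShift 𝒜).obj (regular 𝒜)) (LinearMap.toSpanSingleton A M.carrier m)
    fun i a ha => add_one_one i ▸ M.smul_mem (i := i + 1) (a := a) ha hm

theorem ofEven_one (M : SuperMod 𝒜) (m : M.carrier) (hm : m ∈ M.gr 0) :
    lin (ofEven M m hm) (1 : A) = m := one_smul A m

theorem ofOdd_one (M : SuperMod 𝒜) (m : M.carrier) (hm : m ∈ M.gr 1) :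
    lin (ofOdd M m hm) (1 : A) = m := one_smul A m

theorem regular_hom_ext {M : SuperMod 𝒜} {f g : regular 𝒜 ⟶ M}
    (h : lin f (1 : A) = lin g (1 : A)) : f = g :=
  lin_injective (LinearMap.ext_ring h)

/-- The regular supermodule and its parity shift generate. -/
theorem eq_zero_of_comp {M N : SuperMod 𝒜} (f : M ⟶ N)
    (h0 : ∀ g : regular 𝒜 ⟶ M, g ≫ f = 0)
    (h1 : ∀ g : (parityShift 𝒜).obj (regular 𝒜) ⟶ M, g ≫ f = 0) : f = 0 := by
  refine hom_ext fun x => ?_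
  obtain ⟨a, ha, b, hb, rfl⟩ := M.exists_add x
  have ea := congrArg (fun l => lin l (1 : A)) (h0 (ofEven M a ha))
  have eb := congrArg (fun l => lin l (1 : A)) (h1 (ofOdd M b hb))
  change lin f (lin (ofEven M a ha) (1 : A)) = 0 at ea
  change lin f (lin (ofOdd M b hb) (1 : A)) = 0 at eb
  rw [ofEven_one] at ea
  rw [ofOdd_one] at eb
  rw [map_add, ea, eb, add_zero]
  rfl

end

variable {B : Type u} [Ring B] [Algebra k B] {ℬ : ZMod 2 → Submodule k B}

/-- Vanishing of `η` passes from `T` and `ΠT` to the regular supermodule of `B`. Strongness of the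
inverse functor enters through `v` and `v'`: source and target lie in the same degree `m`, so the
question becomes one about a morphism of supermodules. -/
theorem app_regular_eq_zero [GradedAlgebra 𝒜] [Module.Finite k A] [GradedAlgebra ℬ]
    [Module.Finite k B] (Φ : PiFunctor 𝒜 ℬ) (Ψ : PiFunctor ℬ 𝒜)
    (unit : 𝟭 (Db 𝒜) ≅ Φ.F ⋙ Ψ.F) (counit : Ψ.F ⋙ Φ.F ≅ 𝟭 (Db ℬ))
    {T : SuperMod ℬ} {n : ℤ}
    (e : Φ.F.obj ((singleDb 𝒜 0).obj (regular 𝒜)) ≅ (singleDb ℬ n).obj T)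
    {H : SuperMod ℬ ⥤ SuperMod ℬ} [H.Additive] [PreservesFiniteLimits H]
    [PreservesFiniteColimits H] (η : 𝟭 (SuperMod ℬ) ⟶ H)
    (hT : η.app T = 0) (hT' : η.app ((parityShift ℬ).obj T) = 0) {S S' : SuperMod 𝒜} {m : ℤ}
    (v : Ψ.F.obj ((singleDb ℬ 0).obj (regular ℬ)) ≅ (singleDb 𝒜 m).obj S)
    (v' : Ψ.F.obj ((singleDb ℬ 0).obj (H.obj (regular ℬ))) ≅ (singleDb 𝒜 m).obj S') :
    η.app (regular ℬ) = 0 := by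
  have := Φ.linear
  have : Φ.F.Faithful := Functor.Faithful.of_comp_iso unit.symm
  have : Ψ.F.Faithful := Functor.Faithful.of_comp_iso counit
  have : Φ.F.IsEquivalence :=
    (CategoryTheory.Equivalence.mk Φ.F Ψ.F unit counit).isEquivalence_functor
  have : Ψ.F.IsEquivalence :=
    (CategoryTheory.Equivalence.mk Φ.F Ψ.F unit counit).isEquivalence_inverse
  let f := (singleDb ℬ 0).map (η.app (regular ℬ))
  -- After applying `Φ.F` and the counit, `q` becomes a morphism from `Y` in degree `n + m` to the
  -- regular supermodule in degree `0`; composing it with `η` gives zero since `η` vanishes on `Y`.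
  have key {X : SuperMod 𝒜} {Y : SuperMod ℬ} (hY : η.app Y = 0)
      (e' : Φ.F.obj ((singleDb 𝒜 0).obj X) ≅ (singleDb ℬ n).obj Y)
      (q : (singleDb 𝒜 m).obj X ⟶ Ψ.F.obj ((singleDb ℬ 0).obj (regular ℬ))) :
      q ≫ Ψ.F.map f = 0 := by
    obtain ⟨w⟩ := Φ.singleDb_iso e' m
    apply Φ.F.map_injective
    have nat := counit.hom.naturality f
    have h0 : (w.inv ≫ Φ.F.map q ≫ counit.hom.app _) ≫ f = 0 :=
      ObjectProperty.hom_ext _ (comp_singleFunctor_map_eq_zero η hY _)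
    dsimp at nat
    rw [← cancel_mono (counit.hom.app _), ← cancel_epi w.inv, Functor.map_comp, Category.assoc,
      nat, Functor.map_zero, zero_comp, comp_zero]
    simpa only [Category.assoc] using h0
  -- Fullness in the common degree `m` turns the morphism into a map `S ⟶ S'`, which can be tested
  -- on the two generators.
  obtain ⟨g, hg⟩ := (singleDb 𝒜 m).map_surjective (v.inv ≫ Ψ.F.map f ≫ v'.hom)
  obtain ⟨eT⟩ := Φ.singleDb_parityShift_iso e
  have hg0 : g = 0 := by
    refine eq_zero_of_comp g (fun p => (singleDb 𝒜 m).map_injective ?_)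
      (fun p => (singleDb 𝒜 m).map_injective ?_)
    · have := key hT e ((singleDb 𝒜 m).map p ≫ v.inv)
      rw [Functor.map_comp, hg, ← Category.assoc, ← Category.assoc, this, zero_comp,
        Functor.map_zero]
    · have := key hT' eT ((singleDb 𝒜 m).map p ≫ v.inv)
      rw [Functor.map_comp, hg, ← Category.assoc, ← Category.assoc, this, zero_comp,
        Functor.map_zero]
  rw [hg0, Functor.map_zero] at hg
  have hf : Ψ.F.map f = 0 := by
    rw [← cancel_mono v'.hom, ← cancel_epi v.inv, ← hg, zero_comp, comp_zero]
  exact (singleDb ℬ 0).map_injective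
    ((Ψ.F.map_injective (hf.trans (Ψ.F.map_zero _ _).symm)).trans
      ((singleDb ℬ 0).map_zero _ _).symm)

end SuperMod

/-! ### Sign-twisted action of homogeneous elements -/

namespace SuperMod
variable {k A : Type u} [Field k] [Ring A] [Algebra k A] {𝒜 : ZMod 2 → Submodule k A}

theorem isCompl_gr (M : SuperMod 𝒜) : IsCompl (M.gr 0) (M.gr 1) :=
  (isInternal_iff _).1 M.isInternal

/-- The parity involution `v ↦ (-1)^{∂v} v`. -/
noncomputable def parity (M : SuperMod 𝒜) : Module.End k M.carrier :=
  (M.gr 0).projection (M.gr 1) M.isCompl_gr - (M.gr 1).projection (M.gr 0) M.isCompl_gr.symm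

theorem parity_apply {M : SuperMod 𝒜} {j : ZMod 2} {v : M.carrier} (hv : v ∈ M.gr j) :
    M.parity v = (-1 : A) ^ j.val • v := by
  rcases zmod_two j with rfl | rfl
  · rw [parity, LinearMap.sub_apply, Submodule.projection_apply_of_mem_left _ hv,
      Submodule.projection_apply_of_mem_right _ hv, ZMod.val_zero, pow_zero, one_smul, sub_zero]
  · rw [parity, LinearMap.sub_apply, Submodule.projection_apply_of_mem_left _ hv,
      Submodule.projection_apply_of_mem_right _ hv, ZMod.val_one, pow_one, neg_smul, one_smul,
      zero_sub]

theorem parity_pow_apply {M : SuperMod 𝒜} {j : ZMod 2} {v : M.carrier} (hv : v ∈ M.gr j) (e : ℕ) :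
    (M.parity ^ e) v = (-1 : A) ^ (e * j.val) • v := by
  induction e with
  | zero => simp
  | succ e ih =>
    have h : (-1 : A) ^ (e * j.val) • v ∈ M.gr j := by
      rcases neg_one_pow_eq_or A (e * j.val) with h | h <;> simp [h, hv]
    rw [pow_succ', Module.End.mul_apply, ih, parity_apply h, smul_smul, ← pow_add]
    congr 2
    ring

theorem homog_induction {M : SuperMod 𝒜} {p : M.carrier → Prop}
    (h : ∀ j, ∀ v ∈ M.gr j, p v) (hadd : ∀ v w, p v → p w → p (v + w)) (v : M.carrier) : p v := by
  obtain ⟨a, ha, b, hb, rfl⟩ := M.exists_add v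
  exact hadd _ _ (h 0 a ha) (h 1 b hb)

theorem lin_parity_pow {M N : SuperMod 𝒜} (f : M ⟶ N) (e : ℕ) (v : M.carrier) :
    lin f ((M.parity ^ e) v) = (N.parity ^ e) (lin f v) := by
  induction v using homog_induction with
  | h j v hv => rw [parity_pow_apply hv, parity_pow_apply (lin_mem f hv), map_smul]
  | hadd v w hv hw => simp only [map_add, hv, hw]

/-- The operator `v ↦ (-1)^{e ∂v} z v`. -/
noncomputable def act (M : SuperMod 𝒜) (e : ℕ) : A →ₗ[k] Module.End k M.carrier :=
  LinearMap.mulRight k (M.parity ^ e) ∘ₗ (Algebra.lsmul k k M.carrier).toLinearMap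

theorem act_apply (M : SuperMod 𝒜) (e : ℕ) (z : A) (v : M.carrier) :
    M.act e z v = z • (M.parity ^ e) v := rfl

theorem act_apply_of_mem {M : SuperMod 𝒜} (e : ℕ) (z : A) {j : ZMod 2} {v : M.carrier}
    (hv : v ∈ M.gr j) : M.act e z v = (-1 : A) ^ (e * j.val) • z • v := by
  rw [act_apply, parity_pow_apply hv, smul_smul, smul_smul]
  congr 1
  exact (((Commute.neg_one_left z).pow_left _).eq).symm

theorem act_mem {M : SuperMod 𝒜} (e : ℕ) {z : A} {i j : ZMod 2} (hz : z ∈ 𝒜 i) {v : M.carrier}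
    (hv : v ∈ M.gr j) : M.act e z v ∈ M.gr (i + j) := by
  have := M.smul_mem hz hv
  rw [act_apply_of_mem e z hv]
  rcases neg_one_pow_eq_or A (e * j.val) with h | h <;> simp [h, this]

/-- Moving `z` past `a` costs `(-1)^{e ∂a}`, exactly the extra sign produced by the degree of `a •
v`. The twist thus makes the operator strictly linear. -/
theorem act_smul [GradedAlgebra 𝒜] {M : SuperMod 𝒜} {e : ℕ} {z : A}
    (hz : ∀ j, ∀ y ∈ 𝒜 j, z * y = (-1) ^ (e * j.val) * (y * z)) (a : A) (v : M.carrier) :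
    M.act e z (a • v) = a • M.act e z v := by
  induction a using DirectSum.Decomposition.inductionOn 𝒜 with
  | zero => simp
  | add a b ha hb => simp only [add_smul, map_add, ha, hb]
  | @homogeneous i a =>
    induction v using homog_induction with
    | hadd v w hv hw => simp only [smul_add, map_add, hv, hw]
    | h j v hv =>
      have hs : (-1 : A) ^ (e * (i + j).val) * (-1) ^ (e * i.val) = (-1) ^ (e * j.val) := by
        rw [← pow_add, neg_one_pow_congr]
        have := even_val i j
        simp only [Nat.even_add, Nat.even_mul] at this ⊢
        tauto
      rw [act_apply_of_mem e z hv, act_apply_of_mem e z (M.smul_mem a.2 hv)]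
      simp only [smul_smul]
      rw [hz i a a.2, ← mul_assoc, hs, neg_one_mul_comm]

/-- The natural transformation of the identity functor given by an even element. -/
noncomputable def evenNatTrans [GradedAlgebra 𝒜] {e : ℕ} {z : A} (h0 : z ∈ 𝒜 0)
    (hz : ∀ j, ∀ y ∈ 𝒜 j, z * y = (-1) ^ (e * j.val) * (y * z)) :
    𝟭 (SuperMod 𝒜) ⟶ 𝟭 (SuperMod 𝒜) where
  app M := mk' { M.act e z with map_smul' := act_smul hz }
    fun i _ hv => zero_add i ▸ act_mem e h0 hv
  naturality M N f := hom_ext fun v => by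
    change z • (N.parity ^ e) (lin f v) = lin f (z • (M.parity ^ e) v)
    rw [map_smul, lin_parity_pow]

/-- The natural transformation to the parity shift given by an odd element. -/
noncomputable def oddNatTrans [GradedAlgebra 𝒜] {e : ℕ} {z : A} (h1 : z ∈ 𝒜 1)
    (hz : ∀ j, ∀ y ∈ 𝒜 j, z * y = (-1) ^ (e * j.val) * (y * z)) :
    𝟭 (SuperMod 𝒜) ⟶ parityShift 𝒜 where
  app M := mk' (N := (parityShift 𝒜).obj M) { M.act e z with map_smul' := act_smul hz }
    fun i v hv => show M.act e z v ∈ M.gr (i + 1) from add_comm 1 i ▸ act_mem e h1 hv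
  naturality M N f := hom_ext fun v => by
    change z • (N.parity ^ e) (lin f v) = lin f (z • (M.parity ^ e) v)
    rw [map_smul, lin_parity_pow]

variable {B : Type u} [Ring B] [Algebra k B] {ℬ : ZMod 2 → Submodule k B}

/-- A `z` that annihilates `T` induces the zero map on `T` and `ΠT`, which have the same underlying
module, so its natural transformation vanishes on the regular supermodule; evaluation at `1`
recovers `z`. -/
theorem eq_zero_of_smul_eq_zero [GradedAlgebra 𝒜] [Module.Finite k A] [GradedAlgebra ℬ]
    [Module.Finite k B] (Φ : PiFunctor 𝒜 ℬ) (Ψ : PiFunctor ℬ 𝒜)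
    (unit : 𝟭 (Db 𝒜) ≅ Φ.F ⋙ Ψ.F) (counit : Ψ.F ⋙ Φ.F ≅ 𝟭 (Db ℬ))
    {T : SuperMod ℬ} {n : ℤ}
    (e : Φ.F.obj ((singleDb 𝒜 0).obj (regular 𝒜)) ≅ (singleDb ℬ n).obj T) {S : SuperMod 𝒜} {m : ℤ}
    (v : Ψ.F.obj ((singleDb ℬ 0).obj (regular ℬ)) ≅ (singleDb 𝒜 m).obj S)
    {i : ZMod 2} {d : ℕ} {z : B} (hi : z ∈ ℬ i)
    (hz : ∀ j, ∀ y ∈ ℬ j, z * y = (-1) ^ (d * j.val) * (y * z))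
    (h : ∀ t : T.carrier, z • t = 0) : z = 0 := by
  have h1 : (1 : B) ∈ (regular ℬ).gr 0 := SetLike.one_mem_graded ℬ
  have hz1 : (regular ℬ).act d z (1 : B) = z := by
    rw [act_apply_of_mem d z h1, ZMod.val_zero, mul_zero, pow_zero, one_smul]
    exact mul_one z
  rw [← hz1]
  rcases zmod_two i with rfl | rfl
  · have := app_regular_eq_zero Φ Ψ unit counit e (evenNatTrans hi hz)
      (hom_ext fun t => h _) (hom_ext fun t => h _) v v
    exact congrArg (fun f => lin f (1 : B)) this
  -- For odd `z` the target functor is `Π`; the parity shift keeps the image of the target in degree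
  -- `m`.
  · obtain ⟨v'⟩ := Ψ.singleDb_parityShift_iso v
    have := app_regular_eq_zero Φ Ψ unit counit e (oddNatTrans hi hz)
      (hom_ext fun t => h _) (hom_ext fun t => h _) v v'
    exact congrArg (fun f => lin f (1 : B)) this

end SuperMod

/-! ### Transport of even and odd endomorphisms -/

section

variable {C C' D : Type*} [Category* C] [Category* C'] [Category* D]
  {P : C ⥤ C} {P' : C' ⥤ C'} {Q : D ⥤ D} {ε : P ⋙ P ⟶ 𝟭 C} {ε' : P' ⋙ P' ⟶ 𝟭 C'}
  {δ : Q ⋙ Q ⟶ 𝟭 D}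

/-- The coherence `hξ` is what lets `F` preserve products of two odd morphisms; without it the two
uses of `ξ` need not match the identification `Π² = Id`. -/
theorem map_odd_comp_odd {F : C ⥤ D} (ξ : F ⋙ Q ≅ P ⋙ F)
    (hξ : ∀ X, Q.map (ξ.hom.app X) ≫ ξ.hom.app (P.obj X) ≫ F.map (ε.app X) = δ.app (F.obj X))
    {X Y Z : C} (f : X ⟶ P.obj Y) (g : Y ⟶ P.obj Z) :
    F.map (f ≫ P.map g ≫ ε.app Z) =
      (F.map f ≫ ξ.inv.app Y) ≫ Q.map (F.map g ≫ ξ.inv.app Z) ≫ δ.app (F.obj Z) := by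
  have h := ξ.inv.naturality g
  dsimp at h
  have h' : Q.map (ξ.inv.app Z) ≫ Q.map (ξ.hom.app Z) = 𝟙 _ := by simp [← Q.map_comp]
  rw [← hξ]
  simp only [Functor.map_comp, Category.assoc]
  rw [reassoc_of% h', ← reassoc_of% h]
  simp

variable [Preadditive C] [Preadditive C'] [Preadditive D]

/-- Fully faithful functors compatible with parity shifts identify the even and the odd
endomorphisms of objects whose images are isomorphic. -/
theorem exists_transport (k : Type*) [Field k]
    [CategoryTheory.Linear k C] [CategoryTheory.Linear k C'] [CategoryTheory.Linear k D]
    {L : C ⥤ D} {J : C' ⥤ D} [L.Additive] [L.Linear k] [L.Full] [L.Faithful]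
    [J.Additive] [J.Linear k] [J.Full] [J.Faithful]
    (ξ : L ⋙ Q ≅ P ⋙ L) (ξ' : J ⋙ Q ≅ P' ⋙ J)
    (hξ : ∀ X, Q.map (ξ.hom.app X) ≫ ξ.hom.app (P.obj X) ≫ L.map (ε.app X) = δ.app (L.obj X))
    (hξ' : ∀ X, Q.map (ξ'.hom.app X) ≫ ξ'.hom.app (P'.obj X) ≫ J.map (ε'.app X) =
      δ.app (J.obj X)) {X : C} {Y : C'} (e : L.obj X ≅ J.obj Y) :
    ∃ (t : (X ⟶ X) ≃ₗ[k] (Y ⟶ Y)) (s : (X ⟶ P.obj X) ≃ₗ[k] (Y ⟶ P'.obj Y)),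
      t (𝟙 X) = 𝟙 Y ∧ (∀ f g, t (f ≫ g) = t f ≫ t g) ∧ (∀ f g, s (f ≫ g) = t f ≫ s g) ∧
      (∀ f g, s (f ≫ P.map g) = s f ≫ P'.map (t g)) ∧
      (∀ f g, t (f ≫ P.map g ≫ ε.app X) = s f ≫ P'.map (s g) ≫ ε'.app Y) := by
  let t : (X ⟶ X) ≃ₗ[k] (Y ⟶ Y) :=
    { toFun f := J.preimage (e.inv ≫ L.map f ≫ e.hom)
      invFun f := L.preimage (e.hom ≫ J.map f ≫ e.inv)
      map_add' f g := J.map_injective (by simp)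
      map_smul' c f := J.map_injective (by simp [Functor.map_smul])
      left_inv f := L.map_injective (by simp)
      right_inv f := J.map_injective (by simp) }
  -- Shifted objects are compared through `e` itself, not through an arbitrary isomorphism, so that
  -- even and odd transport are compatible.
  let E : L.obj (P.obj X) ≅ J.obj (P'.obj Y) :=
    (ξ.app X).symm ≪≫ Q.mapIso e ≪≫ ξ'.app Y
  let s : (X ⟶ P.obj X) ≃ₗ[k] (Y ⟶ P'.obj Y) :=
    { toFun f := J.preimage (e.inv ≫ L.map f ≫ E.hom)
      invFun f := L.preimage (e.hom ≫ J.map f ≫ E.inv)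
      map_add' f g := J.map_injective (by simp)
      map_smul' c f := J.map_injective (by simp [Functor.map_smul])
      left_inv f := L.map_injective (by simp)
      right_inv f := J.map_injective (by simp) }
  have ht (f) : J.map (t f) = e.inv ≫ L.map f ≫ e.hom := by simp [t]
  have hs (f) : J.map (s f) = e.inv ≫ L.map f ≫ E.hom := by simp [s]
  have hs' (f) : J.map (s f) ≫ ξ'.inv.app Y = e.inv ≫ (L.map f ≫ ξ.inv.app X) ≫ Q.map e.hom := by
    simp [hs, E]
  refine ⟨t, s, ?_, fun f g => ?_, fun f g => ?_, fun f g => ?_, fun f g => ?_⟩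
  · exact J.map_injective (by simp [ht])
  · exact J.map_injective (by simp [ht])
  · exact J.map_injective (by simp [ht, hs])
  · apply J.map_injective
    have h1 := ξ.inv.naturality g
    have h2 := ξ'.hom.naturality (t g)
    dsimp at h1 h2
    rw [Functor.map_comp, hs, hs, Functor.map_comp]
    simp only [E, Iso.trans_hom, Iso.symm_hom, Iso.app_inv, Iso.app_hom, Functor.mapIso_hom,
      Category.assoc]
    rw [← h2, ht]
    rw [reassoc_of% h1]
    simp
  · apply J.map_injective
    rw [map_odd_comp_odd ξ' hξ', ht, map_odd_comp_odd ξ hξ, hs', hs']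
    have h := δ.naturality e.hom
    dsimp at h
    simp [← h]

end

/-! ### Homogeneous components -/

section

variable {k A : Type u} [Field k] [Ring A] [Algebra k A] (𝒜 : ZMod 2 → Submodule k A)
  [GradedAlgebra 𝒜]

/-- The projection to a homogeneous component. -/
def gradedComponent (i : ZMod 2) : A →ₗ[k] 𝒜 i :=
  DirectSum.component k (ZMod 2) (fun i => 𝒜 i) i ∘ₗ
    (DirectSum.decomposeLinearEquiv 𝒜).toLinearMap

theorem gradedComponent_of_mem {i : ZMod 2} {a : A} (ha : a ∈ 𝒜 i) :
    gradedComponent 𝒜 i a = ⟨a, ha⟩ :=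
  Subtype.ext (DirectSum.decompose_of_mem_same 𝒜 ha)

theorem gradedComponent_of_mem_ne {i j : ZMod 2} {a : A} (ha : a ∈ 𝒜 i) (hij : i ≠ j) :
    gradedComponent 𝒜 j a = 0 :=
  Subtype.ext (DirectSum.decompose_of_mem_ne 𝒜 ha hij)

theorem gradedComponent_add (a : A) :
    (gradedComponent 𝒜 0 a : A) + gradedComponent 𝒜 1 a = a := by
  induction a using DirectSum.Decomposition.inductionOn 𝒜 with
  | zero => simp
  | add a b ha hb =>
    rw [map_add, map_add, Submodule.coe_add, Submodule.coe_add, add_add_add_comm, ha, hb]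
  | @homogeneous i a =>
    rcases SuperMod.zmod_two i with rfl | rfl
    · rw [gradedComponent_of_mem 𝒜 a.2, gradedComponent_of_mem_ne 𝒜 a.2 (by decide)]
      exact add_zero _
    · rw [gradedComponent_of_mem 𝒜 a.2, gradedComponent_of_mem_ne 𝒜 a.2 (by decide)]
      exact zero_add _

end

/-! ### The reversed algebra as graded endomorphisms of `T` -/

namespace SuperMod

variable {k A : Type u} [Field k] [Ring A] [Algebra k A] {𝒜 : ZMod 2 → Submodule k A}

/-- The underlying linear endomorphism of an even endomorphism. -/
def evenEnd (T : SuperMod 𝒜) : (T ⟶ T) →ₗ[k] Module.End k T.carrier where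
  toFun f := (lin f).restrictScalars k
  map_add' _ _ := rfl
  map_smul' _ _ := rfl

/-- The underlying linear endomorphism of an odd endomorphism. -/
def oddEnd (T : SuperMod 𝒜) : (T ⟶ (parityShift 𝒜).obj T) →ₗ[k] Module.End k T.carrier where
  toFun f := (lin f).restrictScalars k
  map_add' _ _ := rfl
  map_smul' _ _ := rfl

section

variable (𝒜) [GradedAlgebra 𝒜] [Module.Finite k A]

/-- Even elements are the even endomorphisms of the regular supermodule. -/
def evenHom : 𝒜 0 ≃ₗ[k] (regular 𝒜 ⟶ regular 𝒜) where
  toFun a := ofEven (regular 𝒜) a.1 a.2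
  invFun f := ⟨lin f (1 : A), lin_mem f (SetLike.one_mem_graded 𝒜)⟩
  map_add' a b := hom_ext fun (x : A) => mul_add x a.1 b.1
  map_smul' c a := hom_ext fun (x : A) => mul_smul_comm c x a.1
  left_inv a := Subtype.ext (one_mul a.1)
  right_inv _ := regular_hom_ext (one_mul (M := A) _)

/-- Odd elements are the odd endomorphisms of the regular supermodule. -/
def oddHom : 𝒜 1 ≃ₗ[k] (regular 𝒜 ⟶ (parityShift 𝒜).obj (regular 𝒜)) where
  toFun a := ofEven ((parityShift 𝒜).obj (regular 𝒜)) a.1 a.2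
  invFun f := ⟨lin f (1 : A), lin_mem f (SetLike.one_mem_graded 𝒜)⟩
  map_add' a b := hom_ext fun (x : A) => mul_add x a.1 b.1
  map_smul' c a := hom_ext fun (x : A) => mul_smul_comm c x a.1
  left_inv a := Subtype.ext (one_mul a.1)
  right_inv _ := regular_hom_ext (one_mul (M := A) _)

end

variable {B : Type u} [Ring B] [Algebra k B] {ℬ : ZMod 2 → Submodule k B}

/-- A right action of `A` on the `B`-supermodule `T` which identifies the opposite algebra of `A`
with the algebra of all `B`-linear endomorphisms of `T`, grading included. -/
structure IsOppositeEnd (𝒜 : ZMod 2 → Submodule k A) (T : SuperMod ℬ)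
    (Θ : A →ₗ[k] Module.End k T.carrier) : Prop where
  injective : Function.Injective Θ
  map_mul (a b : A) : Θ (a * b) = Θ b * Θ a
  map_one : Θ 1 = 1
  map_smul (a : A) (b : B) (v : T.carrier) : Θ a (b • v) = b • Θ a v
  mem {i j : ZMod 2} {a : A} {v : T.carrier} : a ∈ 𝒜 i → v ∈ T.gr j → Θ a v ∈ T.gr (i + j)
  surjective (i : ZMod 2) (f : Module.End k T.carrier) (hf : ∀ (b : B) v, f (b • v) = b • f v)
    (hi : ∀ j, ∀ v ∈ T.gr j, f v ∈ T.gr (i + j)) : ∃ a ∈ 𝒜 i, Θ a = f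

/-- Right multiplication by `a` followed by right multiplication by `b` is right multiplication by
`a * b`; hence diagrammatic composition matches the product, and composition of operators on `T`
reverses it. -/
theorem exists_isOppositeEnd [GradedAlgebra 𝒜] [Module.Finite k A] {T : SuperMod ℬ}
    (t : (regular 𝒜 ⟶ regular 𝒜) ≃ₗ[k] (T ⟶ T))
    (s : (regular 𝒜 ⟶ (parityShift 𝒜).obj (regular 𝒜)) ≃ₗ[k] (T ⟶ (parityShift ℬ).obj T))
    (h1 : t (𝟙 _) = 𝟙 T) (h00 : ∀ f g, t (f ≫ g) = t f ≫ t g)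
    (h01 : ∀ f g, s (f ≫ g) = t f ≫ s g)
    (h10 : ∀ f g, s (f ≫ (parityShift 𝒜).map g) = s f ≫ (parityShift ℬ).map (t g))
    (h11 : ∀ f g, t (f ≫ (parityShift 𝒜).map g ≫ (piPi 𝒜).hom.app (regular 𝒜)) =
      s f ≫ (parityShift ℬ).map (s g) ≫ (piPi ℬ).hom.app T) :
    ∃ Θ : A →ₗ[k] Module.End k T.carrier, IsOppositeEnd 𝒜 T Θ := by
  let Θ : A →ₗ[k] Module.End k T.carrier :=
    (evenEnd T ∘ₗ t.toLinearMap ∘ₗ (evenHom 𝒜).toLinearMap) ∘ₗ gradedComponent 𝒜 0 +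
      (oddEnd T ∘ₗ s.toLinearMap ∘ₗ (oddHom 𝒜).toLinearMap) ∘ₗ gradedComponent 𝒜 1
  have hΘ (a : A) : Θ a = evenEnd T (t (evenHom 𝒜 (gradedComponent 𝒜 0 a))) +
    oddEnd T (s (oddHom 𝒜 (gradedComponent 𝒜 1 a))) := rfl
  have hΘ0 (a : 𝒜 0) : Θ a = evenEnd T (t (evenHom 𝒜 a)) := by
    rw [hΘ, gradedComponent_of_mem 𝒜 a.2, gradedComponent_of_mem_ne 𝒜 a.2 (by decide)]
    simp
  have hΘ1 (a : 𝒜 1) : Θ a = oddEnd T (s (oddHom 𝒜 a)) := by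
    rw [hΘ, gradedComponent_of_mem 𝒜 a.2, gradedComponent_of_mem_ne 𝒜 a.2 (by decide)]
    simp
  have hmem {i j : ZMod 2} {a : A} {v : T.carrier} (ha : a ∈ 𝒜 i) (hv : v ∈ T.gr j) :
      Θ a v ∈ T.gr (i + j) := by
    rcases zmod_two i with rfl | rfl
    · rw [hΘ0 ⟨a, ha⟩, zero_add]
      exact lin_mem (t _) hv
    · rw [hΘ1 ⟨a, ha⟩, add_comm]
      exact lin_mem (N := (parityShift ℬ).obj T) (s _) hv
  have hinj0 (a : 𝒜 0) (h : ∀ v, Θ a v = 0) : a = 0 := by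
    have : t (evenHom 𝒜 a) = 0 := hom_ext fun v => by
      have := h v
      rwa [hΘ0] at this
    simpa using this
  have hinj1 (a : 𝒜 1) (h : ∀ v, Θ a v = 0) : a = 0 := by
    have : s (oddHom 𝒜 a) = 0 := hom_ext fun v => by
      have := h v
      rwa [hΘ1] at this
    simpa using this
  refine ⟨Θ, ?_, fun a b => ?_, ?_, fun a b v => ?_, hmem, fun i f hf hi => ?_⟩
  · refine (injective_iff_map_eq_zero Θ).2 fun a ha => ?_
    -- On homogeneous `v` the even and odd parts of `Θ a v` lie in complementary components, so each
    -- vanishes separately.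
    have h (v : T.carrier) : Θ (gradedComponent 𝒜 0 a) v = 0 ∧
        Θ (gradedComponent 𝒜 1 a) v = 0 := by
      induction v using homog_induction with
      | hadd v w hv hw => simp [hv, hw]
      | h j v hv =>
        have e : Θ (gradedComponent 𝒜 0 a) v + Θ (gradedComponent 𝒜 1 a) v = 0 := by
          rw [← LinearMap.add_apply, ← map_add, gradedComponent_add, ha, LinearMap.zero_apply]
        have m0 := hmem (gradedComponent 𝒜 0 a).2 hv
        have m1 := hmem (gradedComponent 𝒜 1 a).2 hv
        rcases zmod_two j with rfl | rfl
        · exact T.eq_of_add_eq m0 m1 (zero_mem _) (zero_mem _) (e.trans (add_zero 0).symm)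
        · exact (T.eq_of_add_eq m1 m0 (zero_mem _) (zero_mem _)
            ((add_comm _ _).trans (e.trans (add_zero 0).symm))).symm
    rw [← gradedComponent_add 𝒜 a, hinj0 _ fun v => (h v).1, hinj1 _ fun v => (h v).2]
    simp
  · induction a using DirectSum.Decomposition.inductionOn 𝒜 with
    | zero => simp
    | add a a' ha ha' => simp only [add_mul, map_add, ha, ha', mul_add]
    | @homogeneous i a =>
      induction b using DirectSum.Decomposition.inductionOn 𝒜 with
      | zero => simp
      | add b b' hb hb' => simp only [add_mul, map_add, hb, hb', mul_add]
      | @homogeneous j b =>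
        have hab := SetLike.mul_mem_graded a.2 b.2
        rcases zmod_two i with rfl | rfl <;> rcases zmod_two j with rfl | rfl
        · have e : evenHom 𝒜 ⟨a * b, hab⟩ = evenHom 𝒜 a ≫ evenHom 𝒜 b :=
            hom_ext fun (x : A) => (mul_assoc x a.1 b.1).symm
          rw [hΘ0 ⟨a * b, hab⟩, hΘ0, hΘ0, e, h00]
          rfl
        · have e : oddHom 𝒜 ⟨a * b, hab⟩ = evenHom 𝒜 a ≫ oddHom 𝒜 b :=
            hom_ext fun (x : A) => (mul_assoc x a.1 b.1).symm
          rw [hΘ1 ⟨a * b, hab⟩, hΘ0, hΘ1, e, h01]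
          rfl
        · have e : oddHom 𝒜 ⟨a * b, hab⟩ = oddHom 𝒜 a ≫ (parityShift 𝒜).map (evenHom 𝒜 b) :=
            hom_ext fun (x : A) => (mul_assoc x a.1 b.1).symm
          rw [hΘ1 ⟨a * b, hab⟩, hΘ1, hΘ0, e, h10]
          rfl
        -- The product of two odd elements passes through `Π²`; this is the case that needs `h11`.
        · have e : evenHom 𝒜 ⟨a * b, hab⟩ =
              oddHom 𝒜 a ≫ (parityShift 𝒜).map (oddHom 𝒜 b) ≫ (piPi 𝒜).hom.app _ :=
            hom_ext fun (x : A) => (mul_assoc x a.1 b.1).symm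
          rw [hΘ0 ⟨a * b, hab⟩, hΘ1, hΘ1, e, h11]
          rfl
  · have e : evenHom 𝒜 ⟨1, SetLike.one_mem_graded 𝒜⟩ = 𝟙 _ :=
      hom_ext fun (x : A) => mul_one x
    rw [hΘ0 ⟨1, SetLike.one_mem_graded 𝒜⟩, e, h1]
    rfl
  · rw [hΘ, LinearMap.add_apply, LinearMap.add_apply, smul_add]
    exact congrArg₂ _ ((lin (t _)).map_smul b v) ((lin (s _)).map_smul b v)
  · rcases zmod_two i with rfl | rfl
    · let g : T ⟶ T := mk' { f with map_smul' := hf } fun j v hv => zero_add j ▸ hi j v hv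
      refine ⟨(evenHom 𝒜).symm (t.symm g), Subtype.mem _, ?_⟩
      rw [hΘ0, LinearEquiv.apply_symm_apply, LinearEquiv.apply_symm_apply]
      rfl
    · let g : T ⟶ (parityShift ℬ).obj T :=
        mk' (N := (parityShift ℬ).obj T) { f with map_smul' := hf }
          fun j v hv => show f v ∈ T.gr (j + 1) from add_comm 1 j ▸ hi j v hv
      refine ⟨(oddHom 𝒜).symm (s.symm g), Subtype.mem _, ?_⟩
      rw [hΘ1, LinearEquiv.apply_symm_apply, LinearEquiv.apply_symm_apply]
      rfl

theorem PiFunctor.exists_isOppositeEnd [GradedAlgebra 𝒜] [Module.Finite k A]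
    (Φ : PiFunctor 𝒜 ℬ) [Φ.F.Full] [Φ.F.Faithful] {T : SuperMod ℬ} {n : ℤ}
    (e : Φ.F.obj ((singleDb 𝒜 0).obj (regular 𝒜)) ≅ (singleDb ℬ n).obj T) :
    ∃ Θ : A →ₗ[k] Module.End k T.carrier, IsOppositeEnd 𝒜 T Θ := by
  have := Φ.linear
  let := Φ.commShift
  have := Φ.isTriangulated
  have : (singleDb 𝒜 0 ⋙ Φ.F).Additive := inferInstance
  have : (singleDb 𝒜 0 ⋙ Φ.F).Linear k := inferInstance
  obtain ⟨t, s, h1, h00, h01, h10, h11⟩ := exists_transport k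
    (L := singleDb 𝒜 0 ⋙ Φ.F) (J := singleDb ℬ n) (Q := PiDb ℬ) (ε := (piPi 𝒜).hom)
    (ε' := (piPi ℬ).hom) (δ := (piPiDb ℬ).hom)
    (Functor.associator _ _ _ ≪≫ Functor.isoWhiskerLeft (singleDb 𝒜 0) Φ.ξ ≪≫
      (Functor.associator _ _ _).symm ≪≫
      Functor.isoWhiskerRight (singleDbPi 𝒜 0) Φ.F ≪≫ Functor.associator _ _ _)
    (singleDbPi ℬ n) (fun X => by
      -- Coherence for the composite functor: paste the one for `Φ.F` with the one for placement in
      -- degree `0`, using naturality of `ξ`.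
      have h := Φ.ξ_comp ((singleDb 𝒜 0).obj X)
      have h' := Φ.ξ.hom.naturality ((singleDbPi 𝒜 0).hom.app X)
      rw [← singleDbPi_piPi] at h
      dsimp at h h' ⊢
      rw [← h]
      simp [reassoc_of% h']) (singleDbPi_piPi n) e
  exact SuperMod.exists_isOppositeEnd t s h1 h00 h01 h10 h11

end SuperMod

/-! ### Twisted centres and their maps -/

section

variable {k A : Type u} [Field k] [Ring A] [Algebra k A]

/-- Homogeneous elements `x` with `x y = (-1)^{(∂x + c) ∂y} y x` for all homogeneous `y`. -/
def twistedSet (𝒜 : ZMod 2 → Submodule k A) (c : ℕ) : Set A :=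
  {x | ∃ i, x ∈ 𝒜 i ∧ ∀ j, ∀ y ∈ 𝒜 j, x * y = (-1) ^ ((i.val + c) * j.val) * (y * x)}

variable {𝒜 : ZMod 2 → Submodule k A}

/-- The sign rule is imposed on homogeneous generators, each with its own degree, so it survives
projection of the span to one component. -/
theorem gradedComponent_twisted [GradedAlgebra 𝒜] {c : ℕ} {x : A}
    (hx : x ∈ Submodule.span k (twistedSet 𝒜 c)) (i j : ZMod 2) (y : A) (hy : y ∈ 𝒜 j) :
    (gradedComponent 𝒜 i x : A) * y =
      (-1) ^ ((i.val + c) * j.val) * (y * gradedComponent 𝒜 i x) := by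
  induction hx using Submodule.span_induction with
  | mem x hx =>
    obtain ⟨i', hi', h⟩ := hx
    by_cases hii : i' = i
    · subst hii
      rw [gradedComponent_of_mem 𝒜 hi']
      exact h j y hy
    · rw [gradedComponent_of_mem_ne 𝒜 hi' hii]
      simp
  | zero => simp
  | add x x' _ _ hx hx' => simp only [map_add, Submodule.coe_add, add_mul, mul_add, hx, hx']
  | smul r x _ hx =>
    simp only [map_smul, Submodule.coe_smul, smul_mul_assoc, mul_smul_comm, hx]

theorem eq_zero_of_add_eq_zero [GradedAlgebra 𝒜] {a b : A} (ha : a ∈ 𝒜 0) (hb : b ∈ 𝒜 1)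
    (h : a + b = 0) : a = 0 ∧ b = 0 := by
  have h0 := congrArg (gradedComponent 𝒜 0) h
  rw [map_add, gradedComponent_of_mem 𝒜 ha, gradedComponent_of_mem_ne 𝒜 hb (by decide), add_zero,
    map_zero] at h0
  have ha0 : a = 0 := congrArg Subtype.val h0
  exact ⟨ha0, by simpa [ha0] using h⟩

end

namespace SuperMod

variable {k A B : Type u} [Field k] [Ring A] [Algebra k A] {𝒜 : ZMod 2 → Submodule k A}
  [Ring B] [Algebra k B] {ℬ : ZMod 2 → Submodule k B}

theorem map_neg_one_pow_mul {T : SuperMod ℬ} (Θ : A →ₗ[k] Module.End k T.carrier) (n : ℕ) (a : A)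
    (v : T.carrier) : Θ ((-1) ^ n * a) v = (-1 : B) ^ n • Θ a v := by
  rcases Nat.even_or_odd n with hn | hn <;> simp [hn.neg_one_pow]

variable [GradedAlgebra ℬ]

/-- The action `z ↦ (v ↦ (-1)^{(∂z + c) ∂v} z v)`. -/
noncomputable def twistedAct (T : SuperMod ℬ) (c : ℕ) : B →ₗ[k] Module.End k T.carrier :=
  T.act c ∘ₗ (ℬ 0).subtype ∘ₗ gradedComponent ℬ 0 +
    T.act (1 + c) ∘ₗ (ℬ 1).subtype ∘ₗ gradedComponent ℬ 1

theorem twistedAct_of_mem (T : SuperMod ℬ) (c : ℕ) {i : ZMod 2} {z : B} (hz : z ∈ ℬ i) :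
    T.twistedAct c z = T.act (i.val + c) z := by
  have h (z : B) : T.twistedAct c z = T.act c (gradedComponent ℬ 0 z) +
    T.act (1 + c) (gradedComponent ℬ 1 z) := rfl
  rcases zmod_two i with rfl | rfl
  · rw [h, gradedComponent_of_mem ℬ hz, gradedComponent_of_mem_ne ℬ hz (by decide)]
    simp
  · rw [h, gradedComponent_of_mem ℬ hz, gradedComponent_of_mem_ne ℬ hz (by decide), ZMod.val_one]
    simp

/-- Commuting `y` past `x` costs `(-1)^{(∂y + d) ∂x}`, which cancels the sign from applying `y` to
`x v`. The remaining exponent `(∂x + ∂y + c + d) ∂v` has the parity prescribed by `e`. The order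
reversal matches that of `Θ`. -/
theorem twistedAct_mul (T : SuperMod ℬ) {c d e : ℕ} (he : Even (c + d + e))
    {i i' : ZMod 2} {x y : B} (hx : x ∈ ℬ i) (hy : y ∈ ℬ i')
    (hy' : ∀ j, ∀ z ∈ ℬ j, y * z = (-1) ^ ((i'.val + d) * j.val) * (z * y)) :
    T.twistedAct e (x * y) = T.twistedAct d y * T.twistedAct c x := by
  rw [twistedAct_of_mem T e (SetLike.mul_mem_graded hx hy), twistedAct_of_mem T d hy,
    twistedAct_of_mem T c hx]
  refine LinearMap.ext fun v => ?_
  rw [Module.End.mul_apply]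
  induction v using homog_induction with
  | hadd v w hv hw => simp only [map_add, hv, hw]
  | h l v hv =>
    rw [act_apply_of_mem _ y (act_mem _ hx hv), act_apply_of_mem _ x hv,
      act_apply_of_mem _ (x * y) hv]
    simp only [smul_smul]
    rw [neg_one_mul_comm, hy' i x hx]
    simp only [← mul_assoc, ← pow_add]
    congr 3
    rw [neg_one_pow_congr]
    have h1 := even_val i i'
    have h2 := even_val i l
    rcases zmod_two l with rfl | rfl
    · simp
    · simp only [ZMod.val_one, mul_one, Nat.even_add, Nat.even_mul] at he h1 h2 ⊢
      grind

namespace IsOppositeEnd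

variable {T : SuperMod ℬ} {Θ : A →ₗ[k] Module.End k T.carrier}

/-- The operator of `z` is an endomorphism of `T`, hence some `Θ a`. As `Θ y` is `B`-linear, it
commutes with multiplication by `z`; the two orders of composition differ only because `Θ y` shifts
degrees by `∂y`, which gives the sign rule for `a`. -/
theorem exists_eq_twistedAct (h : IsOppositeEnd 𝒜 T Θ) {c : ℕ} {i : ZMod 2} {z : B} (hi : z ∈ ℬ i)
    (hz : ∀ j, ∀ y ∈ ℬ j, z * y = (-1) ^ ((i.val + c) * j.val) * (y * z)) :
    ∃ a ∈ 𝒜 i, Θ a = T.twistedAct c z ∧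
      ∀ j, ∀ y ∈ 𝒜 j, a * y = (-1) ^ ((i.val + c) * j.val) * (y * a) := by
  rw [twistedAct_of_mem T c hi]
  obtain ⟨a, ha, haz⟩ := h.surjective i (T.act (i.val + c) z) (act_smul hz)
    fun j v hv => act_mem _ hi hv
  refine ⟨a, ha, haz, fun j y hy => h.injective (LinearMap.ext fun v => ?_)⟩
  rw [map_neg_one_pow_mul, h.map_mul, h.map_mul, Module.End.mul_apply, Module.End.mul_apply, haz]
  induction v using homog_induction with
  | hadd v w hv hw => simp only [map_add, smul_add, hv, hw]
  | h l v hv =>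
    rw [act_apply_of_mem _ z hv, act_apply_of_mem _ z (h.mem hy hv), h.map_smul, h.map_smul,
      smul_smul ((-1 : B) ^ _) ((-1 : B) ^ _), ← pow_add]
    congr 1
    rw [neg_one_pow_congr]
    have := even_val j l
    simp only [Nat.even_add, Nat.even_mul] at this ⊢
    tauto

/-- The twisted centres of `ℬ` embed into those of `𝒜`, compatibly with products. -/
theorem exists_linearMap [GradedAlgebra 𝒜] (h : IsOppositeEnd 𝒜 T Θ)
    (hT : ∀ (d : ℕ) (i : ZMod 2), ∀ z ∈ ℬ i,
      (∀ j, ∀ y ∈ ℬ j, z * y = (-1) ^ (d * j.val) * (y * z)) →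
      (∀ t : T.carrier, z • t = 0) → z = 0) :
    ∃ φ : ℕ → B →ₗ[k] A,
      (∀ c, ∀ x ∈ Submodule.span k (twistedSet ℬ c), φ c x ∈ Submodule.span k (twistedSet 𝒜 c)) ∧
      (∀ c d e, Even (c + d + e) → ∀ x ∈ Submodule.span k (twistedSet ℬ c),
        ∀ y ∈ Submodule.span k (twistedSet ℬ d), φ e (x * y) = φ c x * φ d y) ∧
      φ 0 1 = 1 ∧
      ∀ c, ∀ x ∈ Submodule.span k (twistedSet ℬ c), φ c x = 0 → x = 0 := by
  -- A linear left inverse of `Θ` makes `φ` defined and linear on all of `B`; on the twisted centres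
  -- the operators lie in the image of `Θ`, so there it is a genuine inverse.
  obtain ⟨r, hr⟩ := LinearMap.exists_leftInverse_of_injective Θ (LinearMap.ker_eq_bot.2 h.injective)
  have hr' {a : A} {f : Module.End k T.carrier} (hf : Θ a = f) : r f = a :=
    hf ▸ LinearMap.congr_fun hr a
  refine ⟨fun c => r ∘ₗ T.twistedAct c, fun c x hx => ?_, fun c d e he x hx y hy => ?_, ?_,
    fun c x hx h0 => ?_⟩
  · induction hx using Submodule.span_induction with
    | mem x hx =>
      obtain ⟨i, hi, hx⟩ := hx
      obtain ⟨a, ha, hax, ha'⟩ := h.exists_eq_twistedAct hi hx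
      rw [LinearMap.comp_apply, hr' hax]
      exact Submodule.subset_span ⟨i, ha, ha'⟩
    | zero => simp
    | add x y _ _ hx hy => rw [_root_.map_add]; exact add_mem hx hy
    | smul s x _ hx => rw [_root_.map_smul]; exact Submodule.smul_mem _ s hx
  · induction hx using Submodule.span_induction with
    | zero => simp
    | add x x' _ _ hx hx' => simp only [add_mul, _root_.map_add, hx, hx']
    | smul s x _ hx => simp only [smul_mul_assoc, _root_.map_smul, hx]
    | mem x hx =>
      induction hy using Submodule.span_induction with
      | zero => simp
      | add y y' _ _ hy hy' => simp only [mul_add, _root_.map_add, hy, hy']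
      | smul s y _ hy => simp only [mul_smul_comm, _root_.map_smul, hy]
      | mem y hy =>
        obtain ⟨i, hi, hx⟩ := hx
        obtain ⟨i', hi', hy⟩ := hy
        obtain ⟨a, ha, hax, -⟩ := h.exists_eq_twistedAct hi hx
        obtain ⟨b, hb, hby, -⟩ := h.exists_eq_twistedAct hi' hy
        rw [LinearMap.comp_apply, LinearMap.comp_apply, LinearMap.comp_apply, hr' hax, hr' hby]
        apply hr'
        rw [h.map_mul, T.twistedAct_mul he hi hi' hy, hax, hby]
  · apply hr'
    rw [h.map_one, twistedAct_of_mem T 0 (SetLike.one_mem_graded ℬ)]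
    exact LinearMap.ext fun v => (one_smul B v).symm
  · have key (i : ZMod 2) : ∃ a ∈ 𝒜 i, Θ a = T.twistedAct c (gradedComponent ℬ i x) ∧
        ∀ j, ∀ y ∈ 𝒜 j, a * y = (-1) ^ ((i.val + c) * j.val) * (y * a) :=
      h.exists_eq_twistedAct (gradedComponent ℬ i x).2 (gradedComponent_twisted hx i)
    obtain ⟨a, ha, hax, -⟩ := key 0
    obtain ⟨b, hb, hbx, -⟩ := key 1
    -- Up to signs the twisted operator of a component is plain multiplication, so if it vanishes
    -- the component annihilates `T`.
    have zero {i : ZMod 2} (hi : T.twistedAct c (gradedComponent ℬ i x) = 0) :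
        (gradedComponent ℬ i x : B) = 0 := by
      refine hT _ i _ (gradedComponent ℬ i x).2 (gradedComponent_twisted hx i) fun t => ?_
      induction t using homog_induction with
      | hadd v w hv hw => rw [smul_add, hv, hw, add_zero]
      | h l v hv =>
        have := LinearMap.congr_fun hi v
        rw [twistedAct_of_mem T c (gradedComponent ℬ i x).2, act_apply_of_mem _ _ hv] at this
        rcases neg_one_pow_eq_or B ((i.val + c) * l.val) with hs | hs <;> simpa [hs] using this
    rw [← gradedComponent_add ℬ x, _root_.map_add, LinearMap.comp_apply, LinearMap.comp_apply,
      hr' hax, hr' hbx] at h0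
    obtain ⟨ha0, hb0⟩ := eq_zero_of_add_eq_zero ha hb h0
    rw [← gradedComponent_add ℬ x, zero (by rw [← hax, ha0, _root_.map_zero]),
      zero (by rw [← hbx, hb0, _root_.map_zero]), add_zero]

end IsOppositeEnd

end SuperMod

/-! ### Algebra maps and the dimension count -/

section

variable {k A B : Type u} [Field k] [Ring A] [Algebra k A] {𝒜 : ZMod 2 → Submodule k A}
  [GradedAlgebra 𝒜] [Ring B] [Algebra k B] {ℬ : ZMod 2 → Submodule k B} [GradedAlgebra ℬ]

/-- The maps `φ 0` and `φ 1` act on the super and anti components. The four products in the direct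
sum are the cases of `hmul` with indices in `{0, 1}` and `c + d + e` even. -/
theorem exists_injective_algHom_of_linearMap (φ : ℕ → B →ₗ[k] A)
    (hmem : ∀ c, ∀ x ∈ Submodule.span k (twistedSet ℬ c),
      φ c x ∈ Submodule.span k (twistedSet 𝒜 c))
    (hmul : ∀ c d e, Even (c + d + e) → ∀ x ∈ Submodule.span k (twistedSet ℬ c),
      ∀ y ∈ Submodule.span k (twistedSet ℬ d), φ e (x * y) = φ c x * φ d y)
    (hone : φ 0 1 = 1)
    (hinj : ∀ c, ∀ x ∈ Submodule.span k (twistedSet ℬ c), φ c x = 0 → x = 0) :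
    (∃ f : superCentre ℬ →ₐ[k] superCentre 𝒜, Function.Injective f) ∧
      ∃ g : SuperAntiSum ℬ →ₐ[k] SuperAntiSum 𝒜, Function.Injective g := by
  refine ⟨⟨AlgHom.ofLinearMap
      { toFun x := ⟨φ 0 x.1, hmem 0 x.1 x.2⟩
        map_add' x y := Subtype.ext (map_add (φ 0) x.1 y.1)
        map_smul' c x := Subtype.ext (map_smul (φ 0) c x.1) }
      (Subtype.ext hone) fun x y => Subtype.ext (hmul 0 0 0 (by decide) x.1 x.2 y.1 y.2), ?_⟩,
    ⟨AlgHom.ofLinearMap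
      { toFun x := (⟨φ 0 x.fst, hmem 0 x.fst x.1.2⟩, ⟨φ 1 x.snd, hmem 1 x.snd x.2.2⟩)
        map_add' x y := SuperAntiSum.ext (map_add (φ 0) x.fst y.fst) (map_add (φ 1) x.snd y.snd)
        map_smul' c x := SuperAntiSum.ext (map_smul (φ 0) c x.fst) (map_smul (φ 1) c x.snd) }
      (SuperAntiSum.ext hone (map_zero (φ 1))) fun x y => SuperAntiSum.ext ?_ ?_, ?_⟩⟩
  · exact (injective_iff_map_eq_zero _).2 fun x hx =>
      Subtype.ext (hinj 0 x.1 x.2 (congrArg Subtype.val hx))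
  · change φ 0 (x.fst * y.fst + x.snd * y.snd) = φ 0 x.fst * φ 0 y.fst + φ 1 x.snd * φ 1 y.snd
    rw [map_add, hmul 0 0 0 (by decide) x.fst x.1.2 y.fst y.1.2,
      hmul 1 1 0 (by decide) x.snd x.2.2 y.snd y.2.2]
  · change φ 1 (x.fst * y.snd + x.snd * y.fst) = φ 0 x.fst * φ 1 y.snd + φ 1 x.snd * φ 0 y.fst
    rw [map_add, hmul 0 1 1 (by decide) x.fst x.1.2 y.snd y.2.2,
      hmul 1 0 1 (by decide) x.snd x.2.2 y.fst y.1.2]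
  · exact (injective_iff_map_eq_zero _).2 fun x hx => SuperAntiSum.ext
      (hinj 0 x.fst x.1.2 (congrArg SuperAntiSum.fst hx))
      (hinj 1 x.snd x.2.2 (congrArg SuperAntiSum.snd hx))

/-- Injections both ways force equal dimensions, so `f` is already bijective; `g` need not be its
inverse. -/
theorem nonempty_algEquiv_of_injective {k X Y : Type*} [Field k] [Ring X] [Ring Y] [Algebra k X]
    [Algebra k Y] [Module.Finite k X] [Module.Finite k Y] {f : X →ₐ[k] Y} {g : Y →ₐ[k] X}
    (hf : Function.Injective f) (hg : Function.Injective g) : Nonempty (X ≃ₐ[k] Y) := by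
  have h := le_antisymm (LinearMap.finrank_le_finrank_of_injective (f := f.toLinearMap) hf)
    (LinearMap.finrank_le_finrank_of_injective (f := g.toLinearMap) hg)
  exact ⟨AlgEquiv.ofBijective f
    ⟨hf, (LinearMap.injective_iff_surjective_of_finrank_eq_finrank (f := f.toLinearMap) h).1 hf⟩⟩

instance [Module.Finite k A] : Module.Finite k (SuperAntiSum 𝒜) :=
  inferInstanceAs (Module.Finite k (superCentre 𝒜 × antiCentre 𝒜))

theorem SuperMod.PiFunctor.exists_injective_algHom [Module.Finite k A] [Module.Finite k B]
    (Φ : SuperMod.PiFunctor 𝒜 ℬ) (Ψ : SuperMod.PiFunctor ℬ 𝒜)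
    (unit : 𝟭 (SuperMod.Db 𝒜) ≅ Φ.F ⋙ Ψ.F) (counit : Ψ.F ⋙ Φ.F ≅ 𝟭 (SuperMod.Db ℬ))
    (hΦ : Φ.IsStrong) (hΨ : Ψ.IsStrong) :
    (∃ f : superCentre ℬ →ₐ[k] superCentre 𝒜, Function.Injective f) ∧
      ∃ g : SuperAntiSum ℬ →ₐ[k] SuperAntiSum 𝒜, Function.Injective g := by
  obtain ⟨n, T, ⟨e⟩⟩ := hΦ
  obtain ⟨m, S, ⟨v⟩⟩ := hΨ
  have : Φ.F.IsEquivalence :=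
    (CategoryTheory.Equivalence.mk Φ.F Ψ.F unit counit).isEquivalence_functor
  obtain ⟨Θ, hΘ⟩ := Φ.exists_isOppositeEnd e
  obtain ⟨φ, hmem, hmul, hone, hinj⟩ := hΘ.exists_linearMap fun d i z hi hz h =>
    SuperMod.eq_zero_of_smul_eq_zero Φ Ψ unit counit e v hi hz h
  exact exists_injective_algHom_of_linearMap φ hmem hmul hone hinj

end

theorem mainTheorem5 {k A B : Type u} [Field k] [IsAlgClosed k] (hk : ringChar k ≠ 2)
    [Ring A] [Algebra k A] [Module.Finite k A] (𝒜 : ZMod 2 → Submodule k A) [GradedAlgebra 𝒜]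
    [Ring B] [Algebra k B] [Module.Finite k B] (ℬ : ZMod 2 → Submodule k B) [GradedAlgebra ℬ]
    (Φ : SuperMod.PiFunctor 𝒜 ℬ) (Ψ : SuperMod.PiFunctor ℬ 𝒜)
    (unit : 𝟭 (SuperMod.Db 𝒜) ≅ Φ.F ⋙ Ψ.F) (counit : Ψ.F ⋙ Φ.F ≅ 𝟭 (SuperMod.Db ℬ))
    (hΦ : Φ.IsStrong) (hΨ : Ψ.IsStrong) :
    Nonempty (superCentre 𝒜 ≃ₐ[k] superCentre ℬ) ∧
      Nonempty (SuperAntiSum 𝒜 ≃ₐ[k] SuperAntiSum ℬ) := by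
  obtain ⟨⟨f, hf⟩, ⟨g, hg⟩⟩ := Φ.exists_injective_algHom Ψ unit counit hΦ hΨ
  -- The hypotheses are symmetric: with unit and counit inverted and exchanged, the same argument
  -- gives embeddings in the other direction.
  obtain ⟨⟨f', hf'⟩, ⟨g', hg'⟩⟩ := Ψ.exists_injective_algHom Φ counit.symm unit.symm hΨ hΦ
  exact ⟨nonempty_algEquiv_of_injective hf' hf, nonempty_algEquiv_of_injective hg' hg⟩
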